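/- Let $\mathbb D=\{|z|<1\}$. Let $\psi$ be analytic and univalent in $\mathbb D$ with $\operatorname{Re}\psi>0$, $\psi(0)=1$, $\psi'(0)>0$ and $\psi(\mathbb D)$ symmetric about the real axis. Let $\mathcal C(\psi)$ be the class of analytic functions $f(z)=z+\sum_{m\ge2}a_mz^m$ in $\mathbb D$ with $1+zf''(z)/f'(z)\prec\psi(z)$. Here $F\prec G$ means $F=G\circ w$ for some analytic $w:\mathbb D\to\mathbb D$ with $w(0)=0$, both for analytic and for harmonic $F,G$. Then there is a unique analytic function $f_0(z)=z+\sum_{m\ge 2}t_mz^m$ in $\mathbb D$ with $1+zf_0''(z)/f_0'(z)=\psi(z)$; the limit $f_0(-1):=\lim_{t\to1^-}f_0(-t)$ exists and is a negative real number. Put $\hat f_0(r)=r+\sum_{m\ge2}|t_m|r^m$. Let $K\ge1$ and $k=(K-1)/(K+1)$. The equation $$\frac{2K}{K+1}\,\hat f_0(r)=-f_0(-1)$$ has a unique root $r_0$ in $(0,1)$. Let $h=f+\overline g$ be a sense-preserving $K$-quasiconformal harmonic mapping of $\mathbb D$, that is, $f,g$ are analytic in $\mathbb D$, $g(0)=0$,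 $h$ is a homeomorphism onto its image, $|f'|^2-|g'|^2>0$ and $|g'/f'|\le k$ in $\mathbb D$; and suppose $f\in\mathcal C(\psi)$. Let $h_1=f_1+\overline{g_1}\prec h$ with $f_1(z)=\sum_{m\ge1}c_mz^m$ and $g_1(z)=\sum_{m\ge1}d_mz^m$ analytic in $\mathbb D$. Then $$\sum_{m=1}^\infty(|c_m|+|d_m|)\,r^m\le d\big(f(0),\partial f(\mathbb D)\big)\qquad\text{for } 0\le r\le r^*=\min\{r_0,1/3\}.$$ The result is sharp when $r^*=r_0$ and all $t_m$ are real and nonnegative (that is, $\hat f_0=f_0$): in that case $f_0\in\mathcal C(\psi)$, $p=f_0+k\overline{f_0}$ is a sense-preserving $K$-quasiconformal harmonic mapping, and for $h_1=h=p$ equality holds in the inequality at $r=r_0$, while the inequality fails for every $r\in(r_0,1)$. -/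

import Mathlib

open Filter Topology Metric Set

/-- The open unit disk. -/
def unitDisk : Set ℂ := ball 0 1

/-- A Schwarz function: holomorphic self-map of the unit disk fixing the origin. -/
structure IsSchwarzFun (w : ℂ → ℂ) : Prop where
  holo : DifferentiableOn ℂ w unitDisk
  mapsTo : MapsTo w unitDisk unitDisk
  zero : w 0 = 0

/-- Subordination `F ≺ G` on the unit disk (for holomorphic or harmonic functions):
`F = G ∘ w` for a Schwarz function `w`. -/
def Subordinate (F G : ℂ → ℂ) : Prop :=
  ∃ w : ℂ → ℂ, IsSchwarzFun w ∧ ∀ z ∈ unitDisk, F z = G (w z)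

/-- The functions `ψ` admitted in the Ma-Minda classes. -/
structure IsMaMinda (ψ : ℂ → ℂ) : Prop where
  holo : DifferentiableOn ℂ ψ unitDisk
  univalent : InjOn ψ unitDisk
  re_pos : ∀ z ∈ unitDisk, 0 < (ψ z).re
  at_zero : ψ 0 = 1
  deriv_re_pos : 0 < (deriv ψ 0).re
  deriv_im : (deriv ψ 0).im = 0
  symm : ∀ v ∈ ψ '' unitDisk, (starRingEnd ℂ) v ∈ ψ '' unitDisk

/-- The class `𝒜`: holomorphic in the unit disk with `f(z) = z + a₂z² + ⋯`. -/
structure IsNormalized (f : ℂ → ℂ) : Prop where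
  holo : DifferentiableOn ℂ f unitDisk
  zero : f 0 = 0
  deriv_zero : deriv f 0 = 1

/-- The expression `1 + z f''(z) / f'(z)`. -/
noncomputable def convexQuotient (f : ℂ → ℂ) (z : ℂ) : ℂ :=
  1 + z * deriv (deriv f) z / deriv f z

/-- The Ma-Minda class `𝒞(ψ)`. The condition `f' ≠ 0` says that `1 + z f''/f'` is
meaningful (holomorphic) throughout the disk. -/
structure IsMaMindaConvex (ψ f : ℂ → ℂ) : Prop where
  normalized : IsNormalized f
  deriv_ne : ∀ z ∈ unitDisk, deriv f z ≠ 0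
  subord : Subordinate (convexQuotient f) ψ

/-- `f₀ ∈ 𝒜` solves `1 + z f₀''(z) / f₀'(z) = ψ(z)` in the unit disk. -/
structure IsConvexExtremal (ψ f₀ : ℂ → ℂ) : Prop where
  normalized : IsNormalized f₀
  deriv_ne : ∀ z ∈ unitDisk, deriv f₀ z ≠ 0
  eqn : ∀ z ∈ unitDisk, convexQuotient f₀ z = ψ z

/-- The harmonic function `f + conj g`. -/
noncomputable def harmonicMap (f g : ℂ → ℂ) (z : ℂ) : ℂ :=
  f z + (starRingEnd ℂ) (g z)

/-- `h = f + conj g`, with `f`, `g` holomorphic in the unit disk and `g(0) = 0`, is a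
sense-preserving `K`-quasiconformal harmonic mapping of the unit disk: a homeomorphism onto its
image with positive Jacobian and `|g'/f'| ≤ (K-1)/(K+1)`. -/
structure IsQuasiconformalHarmonic (K : ℝ) (f g : ℂ → ℂ) : Prop where
  holo_f : DifferentiableOn ℂ f unitDisk
  holo_g : DifferentiableOn ℂ g unitDisk
  g_zero : g 0 = 0
  homeo : IsEmbedding (unitDisk.domRestrict (harmonicMap f g))
  jacobian_pos : ∀ z ∈ unitDisk, 0 < ‖deriv f z‖ ^ 2 - ‖deriv g z‖ ^ 2
  dilatation_le : ∀ z ∈ unitDisk, ‖deriv g z / deriv f z‖ ≤ (K - 1) / (K + 1)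

/-- The `n`-th Taylor coefficient of `f` at the origin. -/
noncomputable def taylorCoeff (f : ℂ → ℂ) (n : ℕ) : ℂ :=
  iteratedDeriv n f 0 / (n.factorial : ℂ)

/-- The majorant `f̂(r) = ∑ |aₙ| rⁿ` of `f(z) = ∑ aₙ zⁿ`. -/
noncomputable def majorant (f : ℂ → ℂ) (r : ℝ) : ℝ :=
  ∑' n : ℕ, ‖taylorCoeff f n‖ * r ^ n

/-- The term `(|c_m| + |d_m|) r^m`, for `f = ∑ c_m z^m`, `g = ∑ d_m z^m`. -/
noncomputable def bohrTerm (f g : ℂ → ℂ) (r : ℝ) (m : ℕ) : ℝ :=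
  (‖taylorCoeff f m‖ + ‖taylorCoeff g m‖) * r ^ m

/-- The sum `∑_{m ≥ 1} (|c_m| + |d_m|) r^m`. -/
noncomputable def bohrSum (f g : ℂ → ℂ) (r : ℝ) : ℝ :=
  ∑' m : ℕ, bohrTerm f g r (m + 1)

/-- The distance from `f(0)` to the boundary of `f(𝔻)`. -/
noncomputable def boundaryDist (f : ℂ → ℂ) : ℝ :=
  infDist (f 0) (frontier (f '' unitDisk))

/-!
For `f ∈ 𝒞(ψ)` the derivative `H = f'` solves `z H' = (ψ(w) - 1) H`, where `w` is a Schwarz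
function, while `G = f₀'` solves `z G' = (ψ - 1) G`. Since the Taylor coefficients of `ψ` satisfy
`|ψₙ| ≤ n |ψ₁|` and `|ψ₁| ≤ 2`, the majorant of `ψ(w) - ψ(w'(0) z)` is `O((1 - |w'(0)|) s²)` on
`[0, 1/3]`, and a Gronwall estimate turns this into a bound for the quotient of `H` by
`G(w'(0) z)`. Replacing `w'(0) z` by `z` in `G` gains a term of order `(1 - |w'(0)|) s`; after
integration the gain wins exactly as far as needed, so `f̂(r) ≤ f̂₀(r)` for `r ≤ 1/3`. Bohr's
inequality handles the dilatation, `ĝ ≤ k f̂`, and the passage from `h` to `h₁ ≺ h`, so that the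
Bohr sum of `h₁` is at most `(1 + k) f̂₀(r)`.

The lower bound `-f₀(-|z|) ≤ |f(z)|`, and hence `-f₀(-1) ≤ d(f(0), ∂f(𝔻))`, comes from a minimum
principle in polar coordinates: it suffices to compare radial derivatives at points where the
angular derivative vanishes. For `|f'|` such a point has `ψ(w)` real, hence `w` real and at least
`-|z|`; for `|f|` it has `z f'/f` real, hence `|f|` has radial derivative `|f'|`.

The Bohr sum of `f₀ + k conj f₀` equals `(1 + k) f̂₀(r)`, and its boundary distance is `-f₀(-1)`,
whence sharpness.
-/

theorem isOpen_unitDisk : IsOpen unitDisk := isOpen_ball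

theorem mem_unitDisk {z : ℂ} : z ∈ unitDisk ↔ ‖z‖ < 1 := mem_ball_zero_iff

theorem zero_mem_unitDisk : (0 : ℂ) ∈ unitDisk := mem_ball_self one_pos

theorem unitDisk_mem_nhds {z : ℂ} (hz : z ∈ unitDisk) : unitDisk ∈ 𝓝 z :=
  isOpen_unitDisk.mem_nhds hz

theorem ofReal_mem_unitDisk {s : ℝ} (h0 : 0 ≤ s) (h1 : s < 1) : (s : ℂ) ∈ unitDisk := by
  rwa [mem_unitDisk, Complex.norm_real, Real.norm_of_nonneg h0]

theorem conj_mem_unitDisk {z : ℂ} (hz : z ∈ unitDisk) : (starRingEnd ℂ) z ∈ unitDisk := by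
  rwa [mem_unitDisk, Complex.norm_conj, ← mem_unitDisk]

theorem mul_mem_unitDisk {c z : ℂ} (hc : ‖c‖ ≤ 1) (hz : z ∈ unitDisk) : c * z ∈ unitDisk := by
  rw [mem_unitDisk, norm_mul]
  exact (mul_le_of_le_one_left (norm_nonneg z) hc).trans_lt (mem_unitDisk.1 hz)

theorem differentiableOn_comp_const_mul {f : ℂ → ℂ} (hf : DifferentiableOn ℂ f unitDisk) {c : ℂ}
    (hc : ‖c‖ ≤ 1) : DifferentiableOn ℂ (fun z => f (c * z)) unitDisk :=
  hf.comp (by fun_prop) fun _ hz => mul_mem_unitDisk hc hz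

/-! ### Taylor coefficients -/

section TaylorCoeff

variable {f g : ℂ → ℂ}

theorem hasSum_taylorCoeff (hf : DifferentiableOn ℂ f unitDisk) {z : ℂ} (hz : z ∈ unitDisk) :
    HasSum (fun n => taylorCoeff f n * z ^ n) (f z) := by
  have taylor := Complex.hasSum_taylorSeries_on_ball hf hz
  simp only [smul_eq_mul, sub_zero] at taylor
  refine taylor.congr_fun fun n => ?_
  rw [taylorCoeff]
  ring

theorem summable_norm_taylorCoeff_mul_pow (hf : DifferentiableOn ℂ f unitDisk) {s : ℝ}
    (h0 : 0 ≤ s) (h1 : s < 1) : Summable fun n => ‖taylorCoeff f n‖ * s ^ n := by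
  simpa [abs_of_nonneg h0] using (hasSum_taylorCoeff hf (ofReal_mem_unitDisk h0 h1)).summable.norm

theorem taylorCoeff_eq_of_hasSum {a : ℕ → ℂ} {ρ : ℝ} (hρ : 0 < ρ)
    (h : ∀ z : ℂ, ‖z‖ < ρ → HasSum (fun n => a n * z ^ n) (f z)) (n : ℕ) :
    taylorCoeff f n = a n := by
  have hseries : HasFPowerSeriesAt f (FormalMultilinearSeries.ofScalars ℂ a) 0 := by
    rw [hasFPowerSeriesAt_iff]
    filter_upwards [ball_mem_nhds (0 : ℂ) hρ] with z hz
    simpa [FormalMultilinearSeries.coeff_ofScalars, mul_comm] using h z (mem_ball_zero_iff.1 hz)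
  have huniq := hseries.analyticAt.hasFPowerSeriesAt.eq_formalMultilinearSeries hseries
  simpa [FormalMultilinearSeries.coeff_ofScalars, taylorCoeff] using
    congrArg (fun p => FormalMultilinearSeries.coeff p n) huniq

theorem taylorCoeff_congr (h : EqOn f g unitDisk) (n : ℕ) : taylorCoeff f n = taylorCoeff g n := by
  have : f =ᶠ[𝓝 0] g := h.eventuallyEq_of_mem (unitDisk_mem_nhds zero_mem_unitDisk)
  rw [taylorCoeff, taylorCoeff, this.iteratedDeriv_eq]

theorem taylorCoeff_zero : taylorCoeff f 0 = f 0 := by simp [taylorCoeff]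

theorem taylorCoeff_one : taylorCoeff f 1 = deriv f 0 := by simp [taylorCoeff]

theorem taylorCoeff_deriv (n : ℕ) : taylorCoeff (deriv f) n = (n + 1) * taylorCoeff f (n + 1) := by
  have hsucc : (n : ℂ) + 1 ≠ 0 := by exact_mod_cast n.succ_ne_zero
  have hfact : (n.factorial : ℂ) ≠ 0 := by exact_mod_cast n.factorial_ne_zero
  simp only [taylorCoeff, iteratedDeriv_succ', Nat.factorial_succ]
  push_cast
  field_simp

theorem taylorCoeff_const (c : ℂ) (n : ℕ) :
    taylorCoeff (fun _ => c) n = if n = 0 then c else 0 := by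
  rw [taylorCoeff, iteratedDeriv_const]
  split_ifs with hn <;> simp [hn]

theorem taylorCoeff_const_mul (c : ℂ) (hf : DifferentiableOn ℂ f unitDisk) (n : ℕ) :
    taylorCoeff (fun z => c * f z) n = c * taylorCoeff f n :=
  taylorCoeff_eq_of_hasSum (a := fun n => c * taylorCoeff f n) one_pos (fun z hz => by
    simpa only [mul_assoc] using (hasSum_taylorCoeff hf (mem_unitDisk.2 hz)).mul_left c) n

theorem taylorCoeff_sub (hf : DifferentiableOn ℂ f unitDisk) (hg : DifferentiableOn ℂ g unitDisk)
    (n : ℕ) : taylorCoeff (fun z => f z - g z) n = taylorCoeff f n - taylorCoeff g n :=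
  taylorCoeff_eq_of_hasSum (a := fun n => taylorCoeff f n - taylorCoeff g n) one_pos (fun z hz => by
    simpa only [sub_mul] using (hasSum_taylorCoeff hf (mem_unitDisk.2 hz)).sub
      (hasSum_taylorCoeff hg (mem_unitDisk.2 hz))) n

theorem taylorCoeff_comp_const_mul (hf : DifferentiableOn ℂ f unitDisk) {c : ℂ} (hc : ‖c‖ ≤ 1)
    (n : ℕ) : taylorCoeff (fun z => f (c * z)) n = taylorCoeff f n * c ^ n :=
  taylorCoeff_eq_of_hasSum (a := fun n => taylorCoeff f n * c ^ n) one_pos (fun z hz => by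
    simpa only [mul_pow, mul_assoc] using
      hasSum_taylorCoeff hf (mul_mem_unitDisk hc (mem_unitDisk.2 hz))) n

theorem taylorCoeff_mul (hf : DifferentiableOn ℂ f unitDisk) (hg : DifferentiableOn ℂ g unitDisk)
    (n : ℕ) : taylorCoeff (fun z => f z * g z) n =
      ∑ kl ∈ Finset.HasAntidiagonal.antidiagonal n, taylorCoeff f kl.1 * taylorCoeff g kl.2 := by
  refine taylorCoeff_eq_of_hasSum (a := fun n => ∑ kl ∈ Finset.HasAntidiagonal.antidiagonal n,
    taylorCoeff f kl.1 * taylorCoeff g kl.2) one_pos (fun z hz => ?_) n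
  have hfz := hasSum_taylorCoeff hf (mem_unitDisk.2 hz)
  have hgz := hasSum_taylorCoeff hg (mem_unitDisk.2 hz)
  have hcauchy := (summable_norm_sum_mul_antidiagonal_of_summable_norm hfz.summable.norm
    hgz.summable.norm).of_norm.hasSum
  rw [← tsum_mul_tsum_eq_tsum_sum_antidiagonal_of_summable_norm hfz.summable.norm
    hgz.summable.norm, hfz.tsum_eq, hgz.tsum_eq] at hcauchy
  refine hcauchy.congr_fun fun m => ?_
  rw [Finset.sum_mul]
  refine Finset.sum_congr rfl fun kl hkl => ?_
  rw [← Finset.HasAntidiagonal.mem_antidiagonal.1 hkl, pow_add]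
  ring

theorem taylorCoeff_id_mul_succ (hf : DifferentiableOn ℂ f unitDisk) (n : ℕ) :
    taylorCoeff (fun z => z * f z) (n + 1) = taylorCoeff f n := by
  refine taylorCoeff_eq_of_hasSum (a := fun n => if n = 0 then 0 else taylorCoeff f (n - 1)) one_pos
    (fun z hz => ?_) (n + 1)
  rw [← hasSum_nat_add_iff' 1, Finset.sum_range_one, if_pos rfl, zero_mul, sub_zero]
  refine ((hasSum_taylorCoeff hf (mem_unitDisk.2 hz)).mul_left z).congr_fun fun n => ?_
  rw [if_neg n.succ_ne_zero, Nat.add_sub_cancel, pow_succ]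
  ring

theorem conj_taylorCoeff (hf : DifferentiableOn ℂ f unitDisk)
    (hconj : ∀ z ∈ unitDisk, f ((starRingEnd ℂ) z) = (starRingEnd ℂ) (f z)) (n : ℕ) :
    (starRingEnd ℂ) (taylorCoeff f n) = taylorCoeff f n := by
  refine (taylorCoeff_eq_of_hasSum (a := fun n => (starRingEnd ℂ) (taylorCoeff f n)) one_pos
    (fun z hz => ?_) n).symm
  have hsum := hasSum_taylorCoeff hf (conj_mem_unitDisk (mem_unitDisk.2 hz))
  rw [hconj z (mem_unitDisk.2 hz)] at hsum
  simpa using Complex.hasSum_conj'.2 hsum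

theorem taylorCoeff_eq_tsum {F : ℕ → ℂ → ℂ} {s : ℝ} (hs : 0 < s) (hs1 : s ≤ 1)
    (hF : ∀ n, DifferentiableOn ℂ (F n) unitDisk)
    (hdouble : Summable fun p : ℕ × ℕ => ‖taylorCoeff (F p.1) p.2‖ * s ^ p.2)
    (hsum : ∀ z : ℂ, ‖z‖ < s → HasSum (fun n => F n z) (f z)) (m : ℕ) :
    taylorCoeff f m = ∑' n, taylorCoeff (F n) m := by
  have hcol (m : ℕ) : Summable fun n => taylorCoeff (F n) m :=
    ((summable_mul_right_iff (pow_pos hs m).ne').1 (hdouble.prod_symm.prod_factor m)).of_norm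
  refine taylorCoeff_eq_of_hasSum (a := fun m => ∑' n, taylorCoeff (F n) m) hs (fun z hz => ?_) m
  have hsumz : Summable fun p : ℕ × ℕ => taylorCoeff (F p.1) p.2 * z ^ p.2 := by
    refine Summable.of_norm_bounded hdouble fun p => ?_
    rw [norm_mul, norm_pow]
    gcongr
  have htotal : HasSum (fun p : ℕ × ℕ => taylorCoeff (F p.1) p.2 * z ^ p.2) (f z) := by
    have hrows := hsumz.hasSum.prod_fiberwise fun n =>
      hasSum_taylorCoeff (hF n) (mem_unitDisk.2 (hz.trans_le hs1))
    rw [← hrows.unique (hsum z hz)]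
    exact hsumz.hasSum
  exact ((Equiv.prodComm ℕ ℕ).hasSum_iff.2 htotal).prod_fiberwise fun m =>
    (hcol m).hasSum.mul_right (z ^ m)

end TaylorCoeff

/-! ### Majorants -/

section Majorant

variable {f g : ℂ → ℂ} {s t : ℝ}

theorem majorant_congr (h : EqOn f g unitDisk) (s : ℝ) : majorant f s = majorant g s := by
  simp only [majorant, taylorCoeff_congr h]

theorem majorant_nonneg (hs : 0 ≤ s) : 0 ≤ majorant f s :=
  tsum_nonneg fun _ => by positivity

theorem majorant_zero : majorant f 0 = ‖f 0‖ := by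
  rw [majorant, tsum_eq_single 0 fun n hn => by rw [zero_pow hn, mul_zero], taylorCoeff_zero,
    pow_zero, mul_one]

theorem majorant_const (c : ℂ) (s : ℝ) : majorant (fun _ => c) s = ‖c‖ := by
  rw [majorant, tsum_eq_single 0 fun n hn => by rw [taylorCoeff_const, if_neg hn, norm_zero,
    zero_mul], taylorCoeff_zero, pow_zero, mul_one]

theorem majorant_const_mul (c : ℂ) (hf : DifferentiableOn ℂ f unitDisk) (s : ℝ) :
    majorant (fun z => c * f z) s = ‖c‖ * majorant f s := by
  simp only [majorant, taylorCoeff_const_mul c hf, norm_mul, mul_assoc, tsum_mul_left]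

theorem majorant_id_mul (hf : DifferentiableOn ℂ f unitDisk) (h0 : 0 ≤ s) (h1 : s < 1) :
    majorant (fun z => z * f z) s = s * majorant f s := by
  have hzf : DifferentiableOn ℂ (fun z => z * f z) unitDisk := differentiableOn_id.mul hf
  rw [majorant, (summable_norm_taylorCoeff_mul_pow hzf h0 h1).tsum_eq_zero_add, majorant,
    ← tsum_mul_left, taylorCoeff_zero, zero_mul, norm_zero, zero_mul, zero_add]
  refine tsum_congr fun n => ?_
  rw [taylorCoeff_id_mul_succ hf, pow_succ]
  ring

theorem majorant_sub_le (hf : DifferentiableOn ℂ f unitDisk) (hg : DifferentiableOn ℂ g unitDisk)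
    (h0 : 0 ≤ s) (h1 : s < 1) :
    majorant (fun z => f z - g z) s ≤ majorant f s + majorant g s := by
  have hfs := summable_norm_taylorCoeff_mul_pow hf h0 h1
  have hgs := summable_norm_taylorCoeff_mul_pow hg h0 h1
  rw [majorant, majorant, majorant, ← hfs.tsum_add hgs]
  refine Summable.tsum_le_tsum (fun n => ?_)
    (summable_norm_taylorCoeff_mul_pow (hf.sub hg) h0 h1) (hfs.add hgs)
  rw [taylorCoeff_sub hf hg, ← add_mul]
  gcongr
  exact norm_sub_le _ _

theorem majorant_add_le (hf : DifferentiableOn ℂ f unitDisk) (hg : DifferentiableOn ℂ g unitDisk)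
    (h0 : 0 ≤ s) (h1 : s < 1) :
    majorant (fun z => f z + g z) s ≤ majorant f s + majorant g s := by
  have hneg := majorant_const_mul (-1) hg s
  simp only [norm_neg, norm_one, one_mul, neg_mul] at hneg
  simpa only [sub_neg_eq_add, hneg] using majorant_sub_le hf hg.fun_neg h0 h1

theorem majorant_mul_le (hf : DifferentiableOn ℂ f unitDisk) (hg : DifferentiableOn ℂ g unitDisk)
    (h0 : 0 ≤ s) (h1 : s < 1) :
    majorant (fun z => f z * g z) s ≤ majorant f s * majorant g s := by
  have hfs := (summable_norm_taylorCoeff_mul_pow hf h0 h1).norm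
  have hgs := (summable_norm_taylorCoeff_mul_pow hg h0 h1).norm
  rw [majorant, majorant, majorant,
    tsum_mul_tsum_eq_tsum_sum_antidiagonal_of_summable_norm hfs hgs]
  refine Summable.tsum_le_tsum (fun n => ?_)
    (summable_norm_taylorCoeff_mul_pow (hf.mul hg) h0 h1)
    (summable_norm_sum_mul_antidiagonal_of_summable_norm hfs hgs).of_norm
  rw [taylorCoeff_mul hf hg]
  calc ‖∑ kl ∈ Finset.HasAntidiagonal.antidiagonal n, taylorCoeff f kl.1 * taylorCoeff g kl.2‖
        * s ^ n
      ≤ (∑ kl ∈ Finset.HasAntidiagonal.antidiagonal n,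
          ‖taylorCoeff f kl.1 * taylorCoeff g kl.2‖) * s ^ n := by
        gcongr
        exact norm_sum_le _ _
    _ = _ := by
        rw [Finset.sum_mul]
        refine Finset.sum_congr rfl fun kl hkl => ?_
        rw [← Finset.HasAntidiagonal.mem_antidiagonal.1 hkl, pow_add, norm_mul]
        ring

theorem majorant_pow_le (hf : DifferentiableOn ℂ f unitDisk) (h0 : 0 ≤ s) (h1 : s < 1) (n : ℕ) :
    majorant (fun z => f z ^ n) s ≤ majorant f s ^ n := by
  induction n with
  | zero => simp only [pow_zero, majorant_const, norm_one, le_refl]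
  | succ n ih =>
    simp only [pow_succ]
    refine (majorant_mul_le (hf.fun_pow n) hf h0 h1).trans ?_
    gcongr
    exact majorant_nonneg h0

theorem majorant_le_tsum {F : ℕ → ℂ → ℂ} {B : ℕ → ℝ}
    (hF : ∀ n, DifferentiableOn ℂ (F n) unitDisk) (h0 : 0 < s) (h1 : s < 1)
    (hf : DifferentiableOn ℂ f unitDisk)
    (hsum : ∀ z : ℂ, ‖z‖ < s → HasSum (fun n => F n z) (f z))
    (hB : ∀ n, majorant (F n) s ≤ B n) (hBs : Summable B) :
    majorant f s ≤ ∑' n, B n := by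
  have hmaj : Summable fun n => majorant (F n) s :=
    hBs.of_nonneg_of_le (fun n => majorant_nonneg h0.le) hB
  have hdouble : Summable fun p : ℕ × ℕ => ‖taylorCoeff (F p.1) p.2‖ * s ^ p.2 := by
    rw [summable_prod_of_nonneg fun p => by positivity]
    exact ⟨fun n => summable_norm_taylorCoeff_mul_pow (hF n) h0.le h1, hmaj⟩
  have hcoeff (m : ℕ) : ‖taylorCoeff f m‖ * s ^ m ≤ ∑' n, ‖taylorCoeff (F n) m‖ * s ^ m := by
    rw [taylorCoeff_eq_tsum h0 h1.le hF hdouble hsum, tsum_mul_right]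
    gcongr
    exact norm_tsum_le_tsum_norm
      ((summable_mul_right_iff (pow_pos h0 m).ne').1 (hdouble.prod_symm.prod_factor m))
  calc majorant f s ≤ ∑' m, ∑' n, ‖taylorCoeff (F n) m‖ * s ^ m :=
        Summable.tsum_le_tsum hcoeff (summable_norm_taylorCoeff_mul_pow hf h0.le h1)
          hdouble.prod_symm.prod
    _ = ∑' n, majorant (F n) s :=
        Summable.tsum_comm (f := fun n m => ‖taylorCoeff (F n) m‖ * s ^ m) hdouble
    _ ≤ _ := hmaj.tsum_le_tsum hB hBs

theorem majorant_mono (hf : DifferentiableOn ℂ f unitDisk) (h0 : 0 ≤ s) (hst : s ≤ t)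
    (h1 : t < 1) : majorant f s ≤ majorant f t :=
  Summable.tsum_le_tsum (fun n => by gcongr)
    (summable_norm_taylorCoeff_mul_pow hf h0 (hst.trans_lt h1))
    (summable_norm_taylorCoeff_mul_pow hf (h0.trans hst) h1)

theorem strictMonoOn_majorant (hf : DifferentiableOn ℂ f unitDisk) (hf1 : deriv f 0 ≠ 0) :
    StrictMonoOn (majorant f) (Ico 0 1) := fun s hs t ht hst =>
  Summable.tsum_lt_tsum (i := 1)
    (fun n => mul_le_mul_of_nonneg_left (pow_le_pow_left₀ hs.1 hst.le n) (norm_nonneg _))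
    (by
      rw [taylorCoeff_one, pow_one, pow_one]
      exact mul_lt_mul_of_pos_left hst (norm_pos_iff.2 hf1))
    (summable_norm_taylorCoeff_mul_pow hf hs.1 hs.2)
    (summable_norm_taylorCoeff_mul_pow hf ht.1 ht.2)

theorem continuousOn_majorant (hf : DifferentiableOn ℂ f unitDisk) :
    ContinuousOn (majorant f) (Ico 0 1) := by
  intro s hs
  obtain ⟨t, hst, ht1⟩ := exists_between hs.2
  have hcont : ContinuousOn (majorant f) (Icc 0 t) := by
    refine continuousOn_tsum (u := fun n => ‖taylorCoeff f n‖ * t ^ n) (fun n => by fun_prop)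
      (summable_norm_taylorCoeff_mul_pow hf (hs.1.trans hst.le) ht1) fun n x hx => ?_
    rw [norm_mul, norm_norm, norm_pow, Real.norm_of_nonneg hx.1]
    gcongr
    exacts [hx.1, hx.2]
  refine (hcont s ⟨hs.1, hst.le⟩).mono_of_mem_nhdsWithin ?_
  filter_upwards [inter_mem_nhdsWithin (Ico (0 : ℝ) 1) (Iio_mem_nhds hst)] with x hx
  exact ⟨hx.1.1, (mem_Iio.1 hx.2).le⟩

theorem intervalIntegrable_majorant (hf : DifferentiableOn ℂ f unitDisk) (h0 : 0 ≤ s) (h1 : s < 1) :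
    IntervalIntegrable (majorant f) MeasureTheory.volume 0 s := by
  refine ContinuousOn.intervalIntegrable ?_
  rw [uIcc_of_le h0]
  exact (continuousOn_majorant hf).mono fun x hx => ⟨hx.1, hx.2.trans_lt h1⟩

theorem integral_majorant (hf : DifferentiableOn ℂ f unitDisk) (h0 : 0 ≤ s) (h1 : s < 1) :
    ∫ u in (0 : ℝ)..s, majorant f u = ∑' n : ℕ, ‖taylorCoeff f n‖ * (s ^ (n + 1) / (n + 1)) := by
  have hterm : HasSum (fun n => ∫ u in (0 : ℝ)..s, ‖taylorCoeff f n‖ * u ^ n)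
      (∫ u in (0 : ℝ)..s, majorant f u) := by
    refine intervalIntegral.hasSum_integral_of_dominated_convergence
      (fun n _ => ‖taylorCoeff f n‖ * s ^ n)
      (fun n => Continuous.aestronglyMeasurable (by fun_prop))
      (fun n => Eventually.of_forall fun u hu => ?_)
      (Eventually.of_forall fun u _ => summable_norm_taylorCoeff_mul_pow hf h0 h1)
      intervalIntegrable_const
      (Eventually.of_forall fun u hu => ?_) <;>
    rw [uIoc_of_le h0] at hu
    · rw [norm_mul, norm_norm, norm_pow, Real.norm_of_nonneg hu.1.le]
      exact mul_le_mul_of_nonneg_left (pow_le_pow_left₀ hu.1.le hu.2 n) (norm_nonneg _)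
    · exact (summable_norm_taylorCoeff_mul_pow hf hu.1.le (hu.2.trans_lt h1)).hasSum
  rw [← hterm.tsum_eq]
  refine tsum_congr fun n => ?_
  rw [intervalIntegral.integral_const_mul, integral_pow, zero_pow n.succ_ne_zero, sub_zero]

theorem majorant_eq_integral (hf : DifferentiableOn ℂ f unitDisk) (h0 : 0 ≤ s) (h1 : s < 1) :
    majorant f s = ‖f 0‖ + ∫ u in (0 : ℝ)..s, majorant (deriv f) u := by
  rw [integral_majorant (hf.deriv isOpen_unitDisk) h0 h1, majorant,
    (summable_norm_taylorCoeff_mul_pow hf h0 h1).tsum_eq_zero_add, taylorCoeff_zero, pow_zero,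
    mul_one]
  congr 1
  refine tsum_congr fun n => ?_
  have hnorm : ‖(n : ℂ) + 1‖ = n + 1 := by exact_mod_cast Complex.norm_natCast (n + 1)
  rw [taylorCoeff_deriv, norm_mul, hnorm]
  field_simp

theorem hasDerivAt_majorant (hf : DifferentiableOn ℂ f unitDisk) (h0 : 0 < s) (h1 : s < 1) :
    HasDerivAt (majorant f) (majorant (deriv f) s) s := by
  have hd := hf.deriv isOpen_unitDisk
  have hcont : ContinuousOn (majorant (deriv f)) (Ioo 0 1) :=
    (continuousOn_majorant hd).mono Ioo_subset_Ico_self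
  have hint := intervalIntegral.integral_hasDerivAt_right (intervalIntegrable_majorant hd h0.le h1)
    (hcont.stronglyMeasurableAtFilter isOpen_Ioo s ⟨h0, h1⟩)
    (hcont.continuousAt (Ioo_mem_nhds h0 h1))
  refine (hint.const_add ‖f 0‖).congr_of_eventuallyEq ?_
  filter_upwards [Ioo_mem_nhds h0 h1] with u hu
  exact majorant_eq_integral hf hu.1.le hu.2

end Majorant

/-! ### Coefficient estimates -/

section Coefficients

open Complex Real

variable {f : ℂ → ℂ} {r : ℝ} {n : ℕ}

theorem sphere_subset_unitDisk (h0 : 0 ≤ r) (h1 : r < 1) : sphere 0 |r| ⊆ unitDisk := by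
  rw [abs_of_nonneg h0]
  exact sphere_subset_closedBall.trans (closedBall_subset_ball h1)

theorem circleAverage_eq_apply_zero (hf : DifferentiableOn ℂ f unitDisk) (h0 : 0 ≤ r)
    (h1 : r < 1) : circleAverage f 0 r = f 0 := by
  refine (hf.diffContOnCl_ball ?_).circleAverage
  rw [abs_of_nonneg h0]
  exact closedBall_subset_ball h1

theorem circleAverage_inv_pow_mul (hf : DifferentiableOn ℂ f unitDisk) (h0 : 0 < r) (h1 : r < 1)
    (n : ℕ) : circleAverage (fun z => (z ^ n)⁻¹ * f z) 0 r = taylorCoeff f n := by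
  have hcauchy := (hf.diffContOnCl_ball (closedBall_subset_ball h1)
    ).circleIntegral_one_div_sub_center_pow_smul h0 n
  have hkernel (z : ℂ) : (z - 0)⁻¹ • ((z ^ n)⁻¹ * f z) = (1 / (z - 0) ^ (n + 1)) • f z := by
    rw [sub_zero, smul_eq_mul, smul_eq_mul, pow_succ', one_div, mul_inv, mul_assoc]
  rw [circleAverage_eq_circleIntegral h0.ne']
  simp only [hkernel]
  rw [hcauchy, smul_smul, taylorCoeff, smul_eq_mul]
  field_simp

theorem continuousOn_inv_pow (n : ℕ) (hr : r ≠ 0) :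
    ContinuousOn (fun z : ℂ => (z ^ n)⁻¹) (sphere 0 |r|) :=
  (continuousOn_pow n).inv₀ fun _ hz =>
    pow_ne_zero n (ne_of_mem_sphere hz (abs_ne_zero.2 hr))

theorem two_mul_re_mul_re_inv_pow {z : ℂ} (hz : z ≠ 0) (n : ℕ) (c w : ℂ) :
    2 * w.re * (c * (z ^ n)⁻¹).re =
      (c * ((z ^ n)⁻¹ * w) + (starRingEnd ℂ) c / (‖z‖ ^ 2) ^ n * (z ^ n * w)).re := by
  have hconj : (starRingEnd ℂ) (c * (z ^ n)⁻¹) = (starRingEnd ℂ) c / (‖z‖ ^ 2) ^ n * z ^ n := by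
    have : (starRingEnd ℂ) z ≠ 0 := (map_ne_zero _).2 hz
    rw [← conj_mul', mul_pow, map_mul, map_inv₀, map_pow]
    field_simp
  rw [← mul_assoc, ← mul_assoc, ← hconj, ← add_mul, add_conj, re_ofReal_mul]
  ring

/- On the circle the conjugate of `c z⁻ⁿ` is a multiple of `zⁿ`, so the conjugate half of the
product of real parts integrates to zero. -/
theorem circleAverage_re_mul_re (hf : DifferentiableOn ℂ f unitDisk) (h0 : 0 < r) (h1 : r < 1)
    (hn : n ≠ 0) (c : ℂ) :
    circleAverage (fun z => 2 * (f z).re * (c * (z ^ n)⁻¹).re) 0 r = (c * taylorCoeff f n).re := by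
  have hzf : DifferentiableOn ℂ (fun z => z ^ n * f z) unitDisk := (differentiableOn_pow n).mul hf
  have hcont : ContinuousOn f (sphere 0 |r|) :=
    hf.continuousOn.mono (sphere_subset_unitDisk h0.le h1)
  set d : ℂ := (starRingEnd ℂ) c / (r ^ 2) ^ n
  have hneg : CircleIntegrable (c • fun z => (z ^ n)⁻¹ * f z) 0 r :=
    (((continuousOn_inv_pow n h0.ne').mul hcont).const_smul c).circleIntegrable'
  have hpos : CircleIntegrable (d • fun z => z ^ n * f z) 0 r :=
    (((continuousOn_pow n).mul hcont).const_smul d).circleIntegrable'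
  have hsplit : EqOn (fun z => 2 * (f z).re * (c * (z ^ n)⁻¹).re)
      (reCLM ∘ ((c • fun z => (z ^ n)⁻¹ * f z) + d • fun z => z ^ n * f z)) (sphere 0 |r|) := by
    intro z hz
    have hz' : ‖z‖ = r := by rwa [mem_sphere_zero_iff_norm, abs_of_pos h0] at hz
    have hz0 : z ≠ 0 := norm_pos_iff.1 (hz' ▸ h0)
    dsimp only
    rw [two_mul_re_mul_re_inv_pow hz0, hz']
    rfl
  rw [circleAverage_congr_sphere hsplit, reCLM.circleAverage_comp_comm (hneg.add hpos),
    circleAverage_add hneg hpos, circleAverage_smul, circleAverage_smul,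
    circleAverage_inv_pow_mul hf h0 h1, circleAverage_eq_apply_zero hzf h0.le h1, zero_pow hn,
    zero_mul, smul_zero, add_zero, reCLM_apply, smul_eq_mul]

theorem le_of_forall_mul_pow_le {a b : ℝ} (n : ℕ) (h : ∀ r : ℝ, 0 < r → r < 1 → a * r ^ n ≤ b) :
    a ≤ b := by
  have hlim : Tendsto (fun r : ℝ => a * r ^ n) (𝓝[<] 1) (𝓝 (a * 1 ^ n)) :=
    (Continuous.tendsto (by fun_prop) 1).mono_left nhdsWithin_le_nhds
  rw [one_pow, mul_one] at hlim
  refine le_of_tendsto hlim ?_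
  filter_upwards [Ioo_mem_nhdsLT (zero_lt_one' ℝ)] with r hr using h r hr.1 hr.2

theorem exists_norm_one_mul_eq_norm (a : ℂ) : ∃ u : ℂ, ‖u‖ = 1 ∧ u * a = ‖a‖ := by
  rcases eq_or_ne a 0 with rfl | ha
  · exact ⟨1, norm_one, by simp⟩
  · refine ⟨‖a‖ / a, ?_, div_mul_cancel₀ _ ha⟩
    rw [norm_div, norm_real, norm_norm, div_self (norm_ne_zero_iff.2 ha)]

theorem norm_taylorCoeff_le_of_re_nonneg (hf : DifferentiableOn ℂ f unitDisk)
    (hre : ∀ z ∈ unitDisk, 0 ≤ (f z).re) (hn : n ≠ 0) :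
    ‖taylorCoeff f n‖ ≤ 2 * (f 0).re := by
  refine le_of_forall_mul_pow_le n fun r h0 h1 => ?_
  obtain ⟨u, hu, hua⟩ := exists_norm_one_mul_eq_norm (taylorCoeff f n)
  have hcont : ContinuousOn (fun z => (f z).re) (sphere 0 |r|) :=
    continuous_re.comp_continuousOn (hf.continuousOn.mono (sphere_subset_unitDisk h0.le h1))
  have hmean : circleAverage (fun z => (f z).re) 0 r = (f 0).re := by
    rw [← circleAverage_eq_apply_zero hf h0.le h1]
    exact reCLM.circleAverage_comp_comm
      (hf.continuousOn.mono (sphere_subset_unitDisk h0.le h1)).circleIntegrable'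
  have hkernel (z : ℂ) (hz : z ∈ sphere 0 |r|) : (u * (z ^ n)⁻¹).re ≤ (r ^ n)⁻¹ := by
    refine (re_le_norm _).trans_eq ?_
    rw [norm_mul, hu, norm_inv, norm_pow, mem_sphere_zero_iff_norm.1 hz, abs_of_pos h0, one_mul]
  have hle : ‖taylorCoeff f n‖ ≤ 2 * (r ^ n)⁻¹ * (f 0).re :=
    calc ‖taylorCoeff f n‖
        = circleAverage (fun z => 2 * (f z).re * (u * (z ^ n)⁻¹).re) 0 r := by
          rw [circleAverage_re_mul_re hf h0 h1 hn, hua, ofReal_re]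
      _ ≤ circleAverage (fun z => (2 * (r ^ n)⁻¹) • (f z).re) 0 r := by
          refine circleAverage_mono ?_ ?_ fun z hz => ?_
          · exact ((continuousOn_const.mul hcont).mul (continuous_re.comp_continuousOn
              (continuousOn_const.mul (continuousOn_inv_pow n h0.ne')))).circleIntegrable'
          · exact (hcont.const_smul (2 * (r ^ n)⁻¹)).circleIntegrable'
          · rw [smul_eq_mul, mul_assoc, mul_assoc, mul_comm (r ^ n)⁻¹]
            have := hre z (sphere_subset_unitDisk h0.le h1 hz)
            gcongr
            exact hkernel z hz
      _ = 2 * (r ^ n)⁻¹ * (f 0).re := by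
          rw [circleAverage_fun_smul, hmean, smul_eq_mul]
  calc ‖taylorCoeff f n‖ * r ^ n ≤ 2 * (r ^ n)⁻¹ * (f 0).re * r ^ n := by gcongr
    _ = 2 * (f 0).re := by field_simp

theorem abs_im_pow_le (z : ℂ) (n : ℕ) : |(z ^ (n + 1)).im| ≤ (n + 1) * ‖z‖ ^ n * |z.im| := by
  induction n with
  | zero => simp
  | succ n ih =>
    calc |(z ^ (n + 1 + 1)).im| = |(z ^ (n + 1)).re * z.im + (z ^ (n + 1)).im * z.re| := by
          rw [pow_succ, mul_im]
      _ ≤ |(z ^ (n + 1)).re| * |z.im| + |(z ^ (n + 1)).im| * |z.re| := by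
          rw [← abs_mul, ← abs_mul]
          exact abs_add_le _ _
      _ ≤ ‖z‖ ^ (n + 1) * |z.im| + ((n + 1) * ‖z‖ ^ n * |z.im|) * ‖z‖ := by
          gcongr
          · exact (abs_re_le_norm _).trans_eq (norm_pow _ _)
          · exact abs_re_le_norm z
      _ = ((n + 1 : ℕ) + 1) * ‖z‖ ^ (n + 1) * |z.im| := by
          push_cast
          ring

theorem circleAverage_im_mul_im (hf : DifferentiableOn ℂ f unitDisk) (h0 : 0 < r) (h1 : r < 1)
    (hn : n ≠ 0) :
    circleAverage (fun z => 2 * (f z).im * -((z ^ n)⁻¹).im) 0 r = (taylorCoeff f n).re := by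
  have hrotated := circleAverage_re_mul_re (hf.const_mul (-I)) h0 h1 hn I
  rw [taylorCoeff_const_mul _ hf, ← mul_assoc, mul_neg, I_mul_I, neg_neg, one_mul] at hrotated
  simpa using hrotated

theorem norm_taylorCoeff_le_of_typicallyReal (hf : DifferentiableOn ℂ f unitDisk)
    (hconj : ∀ z ∈ unitDisk, f ((starRingEnd ℂ) z) = (starRingEnd ℂ) (f z))
    (him : ∀ z ∈ unitDisk, 0 ≤ (f z).im * z.im) (n : ℕ) :
    ‖taylorCoeff f (n + 1)‖ ≤ (n + 1) * (taylorCoeff f 1).re := by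
  refine le_of_forall_mul_pow_le n fun r h0 h1 => ?_
  have hcont : ContinuousOn (fun z => (f z).im) (sphere 0 |r|) :=
    continuous_im.comp_continuousOn (hf.continuousOn.mono (sphere_subset_unitDisk h0.le h1))
  have hint (m : ℕ) : CircleIntegrable (fun z => 2 * (f z).im * -((z ^ m)⁻¹).im) 0 r :=
    ((continuousOn_const.mul hcont).mul (continuous_im.comp_continuousOn
      (continuousOn_inv_pow m h0.ne')).neg).circleIntegrable'
  have hsign (z : ℂ) (hz : z ∈ unitDisk) : 0 ≤ 2 * (f z).im * -(z⁻¹).im := by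
    rw [inv_im, neg_div, neg_neg, mul_div_assoc', mul_assoc]
    exact div_nonneg (mul_nonneg zero_le_two (him z hz)) (normSq_nonneg z)
  have hreal : ‖taylorCoeff f (n + 1)‖ = |(taylorCoeff f (n + 1)).re| := by
    obtain ⟨x, hx⟩ := conj_eq_iff_real.1 (conj_taylorCoeff hf hconj (n + 1))
    rw [hx, norm_real, ofReal_re, Real.norm_eq_abs]
  have hle : ‖taylorCoeff f (n + 1)‖ ≤ ((n + 1) * (r⁻¹) ^ n) * (taylorCoeff f 1).re := by
    rw [hreal, ← circleAverage_im_mul_im hf h0 h1 n.succ_ne_zero,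
      ← circleAverage_im_mul_im hf h0 h1 one_ne_zero, ← smul_eq_mul, ← circleAverage_fun_smul]
    refine abs_circleAverage_le_circleAverage_abs.trans
      (circleAverage_mono (hint _).abs ((hint 1).const_smul) fun z hz => ?_)
    rw [Pi.abs_apply, abs_mul (2 * (f z).im), abs_neg, smul_eq_mul, pow_one,
      ← abs_of_nonneg (hsign z (sphere_subset_unitDisk h0.le h1 hz)), abs_mul (2 * (f z).im),
      abs_neg, ← inv_pow]
    calc |2 * (f z).im| * |(z⁻¹ ^ (n + 1)).im|
        ≤ |2 * (f z).im| * ((n + 1) * ‖z⁻¹‖ ^ n * |z⁻¹.im|) := by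
          gcongr
          exact abs_im_pow_le _ n
      _ = _ := by
          rw [norm_inv, mem_sphere_zero_iff_norm.1 hz, abs_of_pos h0]
          ring
  calc ‖taylorCoeff f (n + 1)‖ * r ^ n
      ≤ ((n + 1) * (r⁻¹) ^ n) * (taylorCoeff f 1).re * r ^ n := by gcongr
    _ = (n + 1) * (taylorCoeff f 1).re := by
        rw [inv_pow]
        field_simp

end Coefficients

/-! ### Bohr's inequality for subordinate functions -/

section Bohr

variable {f w : ℂ → ℂ} {s M : ℝ}

theorem norm_taylorCoeff_le_of_bounded (hf : DifferentiableOn ℂ f unitDisk)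
    (hM : ∀ z ∈ unitDisk, ‖f z‖ ≤ M) {n : ℕ} (hn : n ≠ 0) :
    ‖taylorCoeff f n‖ ≤ 2 * (M - ‖f 0‖) := by
  obtain ⟨u, hu, hu0⟩ := exists_norm_one_mul_eq_norm (f 0)
  have hre : ∀ z ∈ unitDisk, 0 ≤ ((M : ℂ) - u * f z).re := fun z hz => by
    have hle : (u * f z).re ≤ ‖f z‖ :=
      (Complex.re_le_norm (u * f z)).trans_eq (by rw [norm_mul, hu, one_mul])
    rw [Complex.sub_re, Complex.ofReal_re]
    linarith [hM z hz]
  have hcoeff := norm_taylorCoeff_le_of_re_nonneg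
    ((differentiableOn_const _).fun_sub (hf.const_mul u)) hre hn
  rwa [taylorCoeff_sub (differentiableOn_const _) (hf.const_mul u), taylorCoeff_const, if_neg hn,
    taylorCoeff_const_mul u hf, zero_sub, norm_neg, norm_mul, hu, one_mul, hu0,
    ← Complex.ofReal_sub, Complex.ofReal_re] at hcoeff

theorem majorant_sub_apply_zero_le (hf : DifferentiableOn ℂ f unitDisk)
    (hM : ∀ z ∈ unitDisk, ‖f z‖ ≤ M) (h0 : 0 ≤ s) (h1 : s < 1) :
    majorant (fun z => f z - f 0) s ≤ 2 * (M - ‖f 0‖) * (s / (1 - s)) := by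
  have hsub : DifferentiableOn ℂ (fun z => f z - f 0) unitDisk := hf.sub (differentiableOn_const _)
  have hgeom : HasSum (fun n => 2 * (M - ‖f 0‖) * s * s ^ n) (2 * (M - ‖f 0‖) * s * (1 - s)⁻¹) :=
    (hasSum_geometric_of_lt_one h0 h1).mul_left _
  rw [majorant, (summable_norm_taylorCoeff_mul_pow hsub h0 h1).tsum_eq_zero_add, taylorCoeff_zero,
    sub_self, norm_zero, zero_mul, zero_add, div_eq_mul_inv, ← mul_assoc, ← hgeom.tsum_eq]
  refine Summable.tsum_le_tsum (fun n => ?_)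
    ((summable_nat_add_iff 1).2 (summable_norm_taylorCoeff_mul_pow hsub h0 h1)) hgeom.summable
  rw [taylorCoeff_sub hf (differentiableOn_const _), taylorCoeff_const, if_neg n.succ_ne_zero,
    sub_zero, pow_succ, mul_assoc, mul_comm s]
  gcongr
  exact norm_taylorCoeff_le_of_bounded hf hM n.succ_ne_zero

theorem majorant_le_of_bounded (hf : DifferentiableOn ℂ f unitDisk)
    (hM : ∀ z ∈ unitDisk, ‖f z‖ ≤ M) (h0 : 0 ≤ s) (h1 : s ≤ 1 / 3) : majorant f s ≤ M := by
  have hs1 : s < 1 := by linarith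
  have hhalf : s / (1 - s) ≤ 1 / 2 := by rw [div_le_iff₀ (by linarith)]; linarith
  have hM0 : 0 ≤ M - ‖f 0‖ := sub_nonneg.2 (hM 0 zero_mem_unitDisk)
  calc majorant f s = majorant (fun z => (f z - f 0) + f 0) s := by simp only [sub_add_cancel]
    _ ≤ majorant (fun z => f z - f 0) s + ‖f 0‖ := by
      rw [← majorant_const (f 0) s]
      exact majorant_add_le (hf.sub (differentiableOn_const _)) (differentiableOn_const _) h0 hs1
    _ ≤ 2 * (M - ‖f 0‖) * (1 / 2) + ‖f 0‖ := by
      gcongr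
      exact (majorant_sub_apply_zero_le hf hM h0 hs1).trans (by gcongr)
    _ = M := by ring

namespace IsSchwarzFun

theorem norm_le (hw : IsSchwarzFun w) {z : ℂ} (hz : z ∈ unitDisk) : ‖w z‖ ≤ ‖z‖ :=
  Complex.norm_le_norm_of_mapsTo_ball hw.holo
    (fun _ h => ball_subset_closedBall (hw.mapsTo h)) hw.zero (mem_unitDisk.1 hz)

theorem differentiableOn_comp (hw : IsSchwarzFun w) (hf : DifferentiableOn ℂ f unitDisk) :
    DifferentiableOn ℂ (fun z => f (w z)) unitDisk :=
  hf.comp hw.holo hw.mapsTo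

theorem differentiableOn_dslope (hw : IsSchwarzFun w) :
    DifferentiableOn ℂ (dslope w 0) unitDisk :=
  (Complex.differentiableOn_dslope (unitDisk_mem_nhds zero_mem_unitDisk)).2 hw.holo

theorem norm_dslope_le_one (hw : IsSchwarzFun w) {z : ℂ} (hz : z ∈ unitDisk) :
    ‖dslope w 0 z‖ ≤ 1 := by
  simpa only [div_one] using Complex.norm_dslope_le_div_of_mapsTo_ball hw.holo
    (fun x hx => by rw [hw.zero]; exact ball_subset_closedBall (hw.mapsTo hx)) hz

theorem eq_mul_dslope (hw : IsSchwarzFun w) (z : ℂ) : w z = z * dslope w 0 z := by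
  simpa only [sub_zero, smul_eq_mul, hw.zero] using (sub_smul_dslope w 0 z).symm

theorem norm_deriv_le_one (hw : IsSchwarzFun w) : ‖deriv w 0‖ ≤ 1 := by
  rw [← dslope_same]
  exact hw.norm_dslope_le_one zero_mem_unitDisk

theorem majorant_le (hw : IsSchwarzFun w) (h0 : 0 ≤ s) (h1 : s ≤ 1 / 3) : majorant w s ≤ s := by
  rw [funext hw.eq_mul_dslope, majorant_id_mul hw.differentiableOn_dslope h0 (by linarith)]
  exact mul_le_of_le_one_right h0
    (majorant_le_of_bounded hw.differentiableOn_dslope (fun _ => hw.norm_dslope_le_one) h0 h1)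

theorem majorant_comp_le (hw : IsSchwarzFun w) (hf : DifferentiableOn ℂ f unitDisk) (h0 : 0 ≤ s)
    (h1 : s ≤ 1 / 3) : majorant (fun z => f (w z)) s ≤ majorant f s := by
  have hs1 : s < 1 := by linarith
  rcases h0.eq_or_lt with rfl | hpos
  · rw [majorant_zero, majorant_zero, hw.zero]
  refine majorant_le_tsum (F := fun n z => taylorCoeff f n * w z ^ n)
    (B := fun n => ‖taylorCoeff f n‖ * s ^ n) (fun n => (hw.holo.fun_pow n).const_mul _) hpos hs1
    (hw.differentiableOn_comp hf)
    (fun z hz => hasSum_taylorCoeff hf (hw.mapsTo (mem_unitDisk.2 (hz.trans hs1))))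
    (fun n => ?_) (summable_norm_taylorCoeff_mul_pow hf h0 hs1)
  rw [majorant_const_mul _ (hw.holo.fun_pow n)]
  gcongr
  exact (majorant_pow_le hw.holo h0 hs1 n).trans
    (pow_le_pow_left₀ (majorant_nonneg h0) (hw.majorant_le h0 h1) n)

end IsSchwarzFun

end Bohr

/-! ### Comparison of majorants -/

section GrowthEstimates

theorem hasSum_sq_mul_geometric {s : ℝ} (h0 : 0 ≤ s) (h1 : s < 1) :
    HasSum (fun n : ℕ => (n : ℝ) * (n * s ^ (n - 1))) ((1 + s) / (1 - s) ^ 3) := by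
  have hs : ‖s‖ < 1 := by rwa [Real.norm_of_nonneg h0]
  have hne : 1 - s ≠ 0 := by linarith
  rw [← hasSum_nat_add_iff' 1]
  convert ((hasSum_choose_mul_geometric_of_norm_lt_one 2 hs).mul_left 2).sub
    (hasSum_choose_mul_geometric_of_norm_lt_one 1 hs) using 1
  · ext n
    have hchoose : ((n + 2).choose 2 : ℝ) = (n + 2) * (n + 1) / 2 := by
      rw [Nat.cast_choose_two]; push_cast; ring
    rw [hchoose, Nat.choose_one_right, Nat.add_sub_cancel]
    push_cast
    ring
  · rw [Finset.sum_range_one]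
    push_cast
    field_simp
    ring

theorem exp_mul_two_sub_le {y : ℝ} (h0 : 0 ≤ y) : Real.exp y * (2 - y) ≤ 2 + y := by
  have hmono : MonotoneOn (fun y : ℝ => 2 + y - Real.exp y * (2 - y)) (Ici 0) := by
    refine monotoneOn_of_deriv_nonneg (convex_Ici 0) (by fun_prop) (by fun_prop) (fun x _ => ?_)
    have hderiv : HasDerivAt (fun y : ℝ => 2 + y - Real.exp y * (2 - y))
        (1 - (Real.exp x * (2 - x) + Real.exp x * (-1))) x :=
      ((hasDerivAt_id x).const_add 2).sub ((Real.hasDerivAt_exp x).mul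
        ((hasDerivAt_id x).const_sub 2))
    rw [hderiv.deriv]
    have hinv : Real.exp x * Real.exp (-x) = 1 := by
      rw [← Real.exp_add, add_neg_cancel, Real.exp_zero]
    nlinarith [Real.exp_pos x, Real.add_one_le_exp (-x)]
  have hle := hmono self_mem_Ici (mem_Ici.2 h0) h0
  simp only [Real.exp_zero] at hle
  linarith

theorem sq_mul_exp_le_one {c y : ℝ} (hc : 0 ≤ c) (hy : y ≤ 2 * (1 - c)) :
    c ^ 2 * Real.exp y ≤ 1 := by
  have hce : c ≤ Real.exp (c - 1) := by linarith [Real.add_one_le_exp (c - 1)]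
  calc c ^ 2 * Real.exp y ≤ Real.exp (c - 1) ^ 2 * Real.exp y := by gcongr
    _ = Real.exp (2 * (c - 1) + y) := by rw [Real.exp_add, ← Real.exp_nat_mul]; push_cast; rfl
    _ ≤ 1 := Real.exp_le_one_iff.2 (by linarith)

/-- The antiderivative of `s (1 + s) / (1 - s)⁴` vanishing at `0`. It controls the growth of the
majorant of a quotient of two solutions of logarithmic derivative equations. -/
noncomputable def growthExponent (s : ℝ) : ℝ := s ^ 2 * (3 + s) / (6 * (1 - s) ^ 3)

theorem growthExponent_zero : growthExponent 0 = 0 := by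
  rw [growthExponent, zero_pow two_ne_zero, zero_mul, zero_div]

theorem hasDerivAt_growthExponent {s : ℝ} (h1 : s < 1) :
    HasDerivAt growthExponent (s * (1 + s) / (1 - s) ^ 4) s := by
  have hne : 1 - s ≠ 0 := by linarith
  have hnum : HasDerivAt (fun s : ℝ => s ^ 2 * (3 + s)) (2 * s * (3 + s) + s ^ 2 * 1) s := by
    simpa using (hasDerivAt_pow 2 s).fun_mul ((hasDerivAt_id' s).const_add 3)
  have hden : HasDerivAt (fun s : ℝ => 6 * (1 - s) ^ 3) (6 * (3 * (1 - s) ^ 2 * (-1))) s := by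
    simpa using (((hasDerivAt_id' s).const_sub 1).fun_pow 3).const_mul 6
  refine (hnum.div hden (by positivity)).congr_deriv ?_
  field_simp
  ring

theorem growthExponent_nonneg {s : ℝ} (h0 : 0 ≤ s) (h1 : s < 1) : 0 ≤ growthExponent s :=
  div_nonneg (mul_nonneg (sq_nonneg s) (by linarith))
    (mul_nonneg (by norm_num) (pow_nonneg (by linarith) 3))

theorem growthExponent_le_quarter {s : ℝ} (h1 : s ≤ 1 / 3) : growthExponent s ≤ 1 / 4 := by
  have hpos : 0 < 1 - s := by linarith
  have hcube : 8 / 27 ≤ (1 - s) ^ 3 := by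
    calc (8 / 27 : ℝ) = (2 / 3) ^ 3 := by norm_num
      _ ≤ _ := by gcongr; linarith
  rw [growthExponent, div_le_iff₀ (by positivity)]
  nlinarith

/-- A polynomial dominating `2 * growthExponent` on `[0, 1/3]` with enough room to absorb the
factors `1 + 2 s` and `(1 - 2 * growthExponent s)⁻¹`, and whose integral over `[0, r]` is still at
most `r² / 2` for `r ≤ 1/3`. -/
noncomputable def growthPolynomial (s : ℝ) : ℝ := s ^ 2 * (1 + 6 * s + 4 * s ^ 2 + 81 * s ^ 3)

theorem continuous_growthPolynomial : Continuous growthPolynomial := by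
  unfold growthPolynomial
  fun_prop

theorem two_mul_growthExponent_mul_le {s : ℝ} (h0 : 0 ≤ s) (h1 : s ≤ 1 / 3) :
    2 * growthExponent s * (1 + 2 * s) ≤ growthPolynomial s := by
  have hpos : 0 < 1 - s := by linarith
  have hquot : 2 * growthExponent s * (1 + 2 * s) =
      s ^ 2 * ((3 + s) * (1 + 2 * s)) / (3 * (1 - s) ^ 3) := by
    unfold growthExponent; field_simp; ring
  rw [hquot, div_le_iff₀ (by positivity), growthPolynomial, mul_assoc]
  refine mul_le_mul_of_nonneg_left ?_ (sq_nonneg s)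
  have hpoly : 0 ≤ 2 - 35 * s + 258 * s ^ 2 - 711 * s ^ 3 + 717 * s ^ 4 - 243 * s ^ 5 := by
    have h2 : 0 ≤ 1 / 3 - s := by linarith
    nlinarith [sq_nonneg (s - 1 / 10), sq_nonneg (s - 1 / 3), mul_nonneg h0 h2,
      mul_nonneg h0 (sq_nonneg (s - 1 / 5)), mul_nonneg h0 (sq_nonneg (s - 1 / 3)),
      mul_nonneg (mul_nonneg h0 h0) (sq_nonneg (s - 1 / 3)), mul_nonneg (pow_nonneg h0 4) h2,
      mul_nonneg (pow_nonneg h0 3) h2, mul_nonneg (pow_nonneg h0 2) h2,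
      mul_nonneg h2 (sq_nonneg (s - 1 / 10))]
  nlinarith [mul_nonneg h0 hpoly]

theorem two_mul_growthExponent_le {s : ℝ} (h0 : 0 ≤ s) (h1 : s ≤ 1 / 3) :
    2 * growthExponent s ≤ growthPolynomial s * (1 - 2 * growthExponent s) := by
  have hpos : 0 < 1 - s := by linarith
  have hquot : 2 * growthExponent s = s ^ 2 * (3 + s) / (3 * (1 - s) ^ 3) := by
    unfold growthExponent; field_simp; ring
  rw [hquot, one_sub_div (by positivity), ← mul_div_assoc]
  refine div_le_div_of_nonneg_right ?_ (by positivity)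
  rw [growthPolynomial, mul_assoc]
  refine mul_le_mul_of_nonneg_left ?_ (sq_nonneg s)
  have h2 : 0 ≤ 1 / 3 - s := by linarith
  nlinarith [sq_nonneg (s - 1 / 10), sq_nonneg (s - 1 / 3), mul_nonneg h0 h2,
    mul_nonneg h0 (sq_nonneg (s - 1 / 5)), mul_nonneg h0 (sq_nonneg (s - 1 / 3)),
    mul_nonneg (mul_nonneg h0 h0) (sq_nonneg (s - 1 / 3)), mul_nonneg (pow_nonneg h0 5) h2,
    mul_nonneg (pow_nonneg h0 4) h2,
    mul_nonneg (pow_nonneg h0 3) h2, mul_nonneg (pow_nonneg h0 2) h2]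

theorem integral_growthPolynomial_sub_nonpos {r : ℝ} (h0 : 0 ≤ r) (h1 : r ≤ 1 / 3) :
    ∫ s in (0 : ℝ)..r, (growthPolynomial s - s) ≤ 0 := by
  have hderiv : ∀ x ∈ uIcc 0 r, HasDerivAt
      (fun r : ℝ => r ^ 3 / 3 + 6 * r ^ 4 / 4 + 4 * r ^ 5 / 5 + 81 * r ^ 6 / 6 - r ^ 2 / 2)
      (growthPolynomial x - x) x := fun x _ => by
    refine ((((((hasDerivAt_pow 3 x).div_const 3).add
      (((hasDerivAt_pow 4 x).const_mul 6).div_const 4)).add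
      (((hasDerivAt_pow 5 x).const_mul 4).div_const 5)).add
      (((hasDerivAt_pow 6 x).const_mul 81).div_const 6)).sub
      ((hasDerivAt_pow 2 x).div_const 2)).congr_deriv ?_
    unfold growthPolynomial; push_cast; ring
  rw [intervalIntegral.integral_eq_sub_of_hasDerivAt hderiv
    ((continuous_growthPolynomial.sub continuous_id).intervalIntegrable _ _)]
  have hbound : r / 3 + 6 * r ^ 2 / 4 + 4 * r ^ 3 / 5 + 81 * r ^ 4 / 6 ≤ 1 / 2 := by
    calc _ ≤ (1 / 3 : ℝ) / 3 + 6 * (1 / 3) ^ 2 / 4 + 4 * (1 / 3) ^ 3 / 5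
          + 81 * (1 / 3) ^ 4 / 6 := by gcongr
      _ ≤ _ := by norm_num
  nlinarith [mul_le_mul_of_nonneg_left hbound (sq_nonneg r)]

variable {s c p : ℝ}

theorem mul_exp_growthExponent_sub_one_le (h0 : 0 ≤ s) (h1 : s ≤ 1 / 3) (c0 : 0 ≤ c)
    (c1 : c ≤ 1) (p0 : 0 ≤ p) (p2 : p ≤ 2) :
    (1 + p * (c * s)) * (Real.exp (2 * (1 - c) * p * growthExponent s) - 1) ≤
      (1 - c) * p * growthPolynomial s := by
  set J := growthExponent s with hJ
  have hJ0 : 0 ≤ J := growthExponent_nonneg h0 (by linarith)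
  have hJ1 : J ≤ 1 / 4 := growthExponent_le_quarter h1
  have hc : 0 ≤ 1 - c := by linarith
  have hpJ : p * J ≤ 1 / 2 := by nlinarith
  have hdamp : 0 < 1 - (1 - c) * (p * J) := by nlinarith [mul_nonneg p0 hJ0]
  have hexp : (Real.exp (2 * (1 - c) * p * J) - 1) * (1 - (1 - c) * (p * J)) ≤
      2 * (1 - c) * p * J := by
    linarith [exp_mul_two_sub_le (y := 2 * (1 - c) * p * J) (by positivity)]
  have hpoly : 2 * J * (1 + p * (c * s)) ≤ growthPolynomial s * (1 - (1 - c) * (p * J)) := by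
    have hmul := two_mul_growthExponent_mul_le h0 h1
    have hdiv := two_mul_growthExponent_le h0 h1
    rw [← hJ] at hmul hdiv
    have hle : 2 * J ≤ growthPolynomial s := by nlinarith
    nlinarith [mul_nonneg (sub_nonneg.2 p2) (sub_nonneg.2 hle),
      mul_nonneg (mul_nonneg p0 c0) (sub_nonneg.2 hmul),
      mul_nonneg (mul_nonneg p0 hc) (sub_nonneg.2 hdiv)]
  refine le_of_mul_le_mul_right ?_ hdamp
  calc _ = (1 + p * (c * s)) *
        ((Real.exp (2 * (1 - c) * p * J) - 1) * (1 - (1 - c) * (p * J))) := by ring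
    _ ≤ (1 + p * (c * s)) * (2 * (1 - c) * p * J) := by gcongr
    _ = (1 - c) * p * (2 * J * (1 + p * (c * s))) := by ring
    _ ≤ (1 - c) * p * (growthPolynomial s * (1 - (1 - c) * (p * J))) := by gcongr
    _ = _ := by ring

theorem mul_exp_growthExponent_sub_le {R gc : ℝ} (h0 : 0 ≤ s) (h1 : s ≤ 1 / 3) (c0 : 0 ≤ c)
    (c1 : c ≤ 1) (p0 : 0 ≤ p) (p2 : p ≤ 2) (hR : 0 ≤ R)
    (hgc : gc ≤ 1 + p * (c * s) + c ^ 2 * R) :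
    gc * Real.exp (2 * (1 - c) * p * growthExponent s) - (1 + p * s + R) ≤
      (1 - c) * p * (growthPolynomial s - s) := by
  set y := 2 * (1 - c) * p * growthExponent s with hy
  have hy2 : y ≤ 2 * (1 - c) := by
    have hpJ : p * growthExponent s ≤ 1 := by
      nlinarith [growthExponent_le_quarter h1, growthExponent_nonneg h0 (by linarith)]
    rw [hy, mul_assoc]
    exact mul_le_of_le_one_right (by linarith) hpJ
  have hremainder : R * (c ^ 2 * Real.exp y) ≤ R :=
    mul_le_of_le_one_right hR (sq_mul_exp_le_one c0 hy2)
  have hmain := mul_exp_growthExponent_sub_one_le h0 h1 c0 c1 p0 p2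
  have hgc' : gc * Real.exp y ≤ (1 + p * (c * s) + c ^ 2 * R) * Real.exp y := by gcongr
  linarith

end GrowthEstimates

section Comparison

variable {φ w G H : ℂ → ℂ} {s p : ℝ}

theorem majorant_id (h0 : 0 ≤ s) (h1 : s < 1) : majorant (fun z => z) s = s := by
  simpa only [mul_one, majorant_const, norm_one] using
    majorant_id_mul (f := fun _ => 1) (differentiableOn_const _) h0 h1

theorem majorant_comp_const_mul {c : ℂ} (hG : DifferentiableOn ℂ G unitDisk) (hc : ‖c‖ ≤ 1)
    (s : ℝ) : majorant (fun z => G (c * z)) s = majorant G (‖c‖ * s) := by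
  simp only [majorant, taylorCoeff_comp_const_mul hG hc, norm_mul, norm_pow, mul_pow, mul_assoc]

theorem majorant_pow_sub_pow_le {a b : ℂ → ℂ} {δ : ℝ} (ha : DifferentiableOn ℂ a unitDisk)
    (hb : DifferentiableOn ℂ b unitDisk) (h0 : 0 ≤ s) (h1 : s < 1) (has : majorant a s ≤ s)
    (hbs : majorant b s ≤ s) (hab : majorant (fun z => a z - b z) s ≤ δ) (n : ℕ) :
    majorant (fun z => a z ^ n - b z ^ n) s ≤ n * s ^ (n - 1) * δ := by
  have hδ : 0 ≤ δ := (majorant_nonneg h0).trans hab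
  induction n with
  | zero => simp [majorant_const]
  | succ n ih =>
    have hpow : DifferentiableOn ℂ (fun z => a z ^ n - b z ^ n) unitDisk :=
      (ha.fun_pow n).fun_sub (hb.fun_pow n)
    have hsub : DifferentiableOn ℂ (fun z => a z - b z) unitDisk := ha.fun_sub hb
    have hbn : majorant (fun z => b z ^ n) s ≤ s ^ n :=
      (majorant_pow_le hb h0 h1 n).trans (pow_le_pow_left₀ (majorant_nonneg h0) hbs n)
    calc majorant (fun z => a z ^ (n + 1) - b z ^ (n + 1)) s
        = majorant (fun z => a z * (a z ^ n - b z ^ n) + (a z - b z) * b z ^ n) s := by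
          congr 1; ext z; ring
      _ ≤ majorant (fun z => a z * (a z ^ n - b z ^ n)) s +
          majorant (fun z => (a z - b z) * b z ^ n) s :=
          majorant_add_le (ha.fun_mul hpow) (hsub.fun_mul (hb.fun_pow n)) h0 h1
      _ ≤ s * (n * s ^ (n - 1) * δ) + δ * s ^ n :=
          add_le_add
            ((majorant_mul_le ha hpow h0 h1).trans (mul_le_mul has ih (majorant_nonneg h0) h0))
            ((majorant_mul_le hsub (hb.fun_pow n) h0 h1).trans
              (mul_le_mul hab hbn (majorant_nonneg h0) hδ))
      _ = (n + 1 : ℕ) * s ^ (n + 1 - 1) * δ := by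
          rcases n with _ | n
          · simp
          · simp only [Nat.add_sub_cancel, pow_succ]; push_cast; ring

theorem IsSchwarzFun.majorant_sub_deriv_mul_le (hw : IsSchwarzFun w) (h0 : 0 ≤ s) (h1 : s < 1) :
    majorant (fun z => w z - deriv w 0 * z) s ≤ s * (2 * (1 - ‖deriv w 0‖) * (s / (1 - s))) := by
  have hfactor : (fun z => w z - deriv w 0 * z) = fun z => z * (dslope w 0 z - dslope w 0 0) := by
    ext z
    rw [dslope_same, hw.eq_mul_dslope z]
    ring
  have hslope := hw.differentiableOn_dslope
  rw [hfactor, majorant_id_mul (hslope.fun_sub (differentiableOn_const _)) h0 h1, ← dslope_same w 0]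
  exact mul_le_mul_of_nonneg_left
    (majorant_sub_apply_zero_le hslope (fun _ => hw.norm_dslope_le_one) h0 h1) h0

theorem IsSchwarzFun.majorant_comp_sub_comp_mul_le (hw : IsSchwarzFun w)
    (hφ : DifferentiableOn ℂ φ unitDisk) (hφp : ∀ n, ‖taylorCoeff φ n‖ ≤ n * p)
    (h0 : 0 < s) (h1 : s ≤ 1 / 3) :
    majorant (fun z => φ (w z) - φ (deriv w 0 * z)) s ≤
      s * (2 * (1 - ‖deriv w 0‖) * p * (s * (1 + s) / (1 - s) ^ 4)) := by
  have hs1 : s < 1 := by linarith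
  set c := deriv w 0
  have hc : ‖c‖ ≤ 1 := hw.norm_deriv_le_one
  have hlin : DifferentiableOn ℂ (fun z => c * z) unitDisk := by fun_prop
  have hlin_le : majorant (fun z => c * z) s ≤ s := by
    rw [majorant_const_mul (f := fun z => z) _ differentiableOn_id, majorant_id h0.le hs1]
    exact mul_le_of_le_one_left h0.le hc
  set δ := s * (2 * (1 - ‖c‖) * (s / (1 - s))) with hδ
  have hpows (n : ℕ) : majorant (fun z => w z ^ n - (c * z) ^ n) s ≤ n * s ^ (n - 1) * δ :=
    majorant_pow_sub_pow_le hw.holo hlin h0.le hs1 (hw.majorant_le h0.le h1) hlin_le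
      (hw.majorant_sub_deriv_mul_le h0.le hs1) n
  have hsum := (hasSum_sq_mul_geometric h0.le hs1).mul_left (p * δ)
  refine (majorant_le_tsum (F := fun n z => taylorCoeff φ n * (w z ^ n - (c * z) ^ n))
    (B := fun n : ℕ => p * δ * ((n : ℝ) * (n * s ^ (n - 1))))
    (fun n => ((hw.holo.fun_pow n).fun_sub (hlin.fun_pow n)).const_mul _) h0 hs1
    ((hw.differentiableOn_comp hφ).fun_sub (differentiableOn_comp_const_mul hφ hc))
    (fun z hz => ?_) (fun n => ?_) hsum.summable).trans_eq ?_
  · have hz := mem_unitDisk.2 (hz.trans hs1)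
    simpa only [mul_sub] using (hasSum_taylorCoeff hφ (hw.mapsTo hz)).sub
      (hasSum_taylorCoeff hφ (mul_mem_unitDisk hc hz))
  · rw [majorant_const_mul _ ((hw.holo.fun_pow n).fun_sub (hlin.fun_pow n))]
    calc _ ≤ (n * p) * (n * s ^ (n - 1) * δ) :=
          mul_le_mul (hφp n) (hpows n) (majorant_nonneg h0.le) ((norm_nonneg _).trans (hφp n))
      _ = _ := by ring
  · have : 1 - s ≠ 0 := by linarith
    rw [hsum.tsum_eq, hδ]
    field_simp

/-- `G` is a normalized holomorphic solution in the unit disk of `z G'(z) = φ(z) G(z)`, i.e.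
`z G' / G = φ` written without division. For `G = f'` and `φ = ψ - 1` it says `1 + z f''/f' = ψ`. -/
structure IsLogDerivSolution (φ G : ℂ → ℂ) : Prop where
  holo : DifferentiableOn ℂ G unitDisk
  at_zero : G 0 = 1
  eqn : ∀ z ∈ unitDisk, z * deriv G z = φ z * G z

namespace IsLogDerivSolution

theorem apply_zero (hG : IsLogDerivSolution φ G) : φ 0 = 0 := by
  simpa only [zero_mul, hG.at_zero, mul_one] using (hG.eqn 0 zero_mem_unitDisk).symm

theorem deriv_eq (hG : IsLogDerivSolution φ G) (hφ : DifferentiableOn ℂ φ unitDisk) :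
    deriv G 0 = deriv φ 0 := by
  have hcoeff := taylorCoeff_congr hG.eqn 1
  rw [← zero_add 1, taylorCoeff_id_mul_succ (hG.holo.deriv isOpen_unitDisk), zero_add,
    taylorCoeff_mul hφ hG.holo, Finset.Nat.antidiagonal_succ] at hcoeff
  simpa [taylorCoeff_zero, taylorCoeff_one, hG.apply_zero, hG.at_zero] using hcoeff

theorem comp_const_mul {c : ℂ} (hG : IsLogDerivSolution φ G) (hc : ‖c‖ ≤ 1) :
    IsLogDerivSolution (fun z => φ (c * z)) (fun z => G (c * z)) where
  holo := differentiableOn_comp_const_mul hG.holo hc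
  at_zero := by rw [mul_zero, hG.at_zero]
  eqn z hz := by
    rw [deriv_comp_mul_left, smul_eq_mul, ← hG.eqn _ (mul_mem_unitDisk hc hz)]
    ring

theorem div {χ : ℂ → ℂ} (hH : IsLogDerivSolution χ H) (hG : IsLogDerivSolution φ G)
    (hne : ∀ z ∈ unitDisk, G z ≠ 0) :
    IsLogDerivSolution (fun z => χ z - φ z) (fun z => H z / G z) where
  holo := hH.holo.fun_div hG.holo hne
  at_zero := by rw [hH.at_zero, hG.at_zero, div_one]
  eqn z hz := by
    have hGz := hne z hz
    rw [deriv_fun_div (hH.holo.differentiableAt (unitDisk_mem_nhds hz))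
      (hG.holo.differentiableAt (unitDisk_mem_nhds hz)) hGz]
    field_simp
    linear_combination G z * hH.eqn z hz - H z * hG.eqn z hz

theorem mul_majorant_deriv_le (hG : IsLogDerivSolution φ G) (hφ : DifferentiableOn ℂ φ unitDisk)
    (h0 : 0 ≤ s) (h1 : s < 1) :
    s * majorant (deriv G) s ≤ majorant φ s * majorant G s := by
  rw [← majorant_id_mul (hG.holo.deriv isOpen_unitDisk) h0 h1, majorant_congr hG.eqn]
  exact majorant_mul_le hφ hG.holo h0 h1

theorem majorant_le_exp {J J' : ℝ → ℝ} (hG : IsLogDerivSolution φ G)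
    (hφ : DifferentiableOn ℂ φ unitDisk) (h0 : 0 ≤ s) (h1 : s < 1) (hJ0 : J 0 = 0)
    (hJ : ∀ t ∈ Icc 0 s, HasDerivAt J (J' t) t)
    (hle : ∀ t ∈ Ioo 0 s, majorant φ t ≤ t * J' t) : majorant G s ≤ Real.exp (J s) := by
  have hderiv : ∀ t ∈ Ioo 0 s, HasDerivAt (fun t => majorant G t * Real.exp (-J t))
      (majorant (deriv G) t * Real.exp (-J t) + majorant G t * (Real.exp (-J t) * -J' t)) t :=
    fun t ht => (hasDerivAt_majorant hG.holo ht.1 (ht.2.trans h1)).mul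
      (hJ t (Ioo_subset_Icc_self ht)).neg.exp
  have hgronwall : ∀ t ∈ Ioo 0 s, majorant (deriv G) t ≤ J' t * majorant G t := fun t ht => by
    refine le_of_mul_le_mul_left ?_ ht.1
    rw [← mul_assoc]
    exact (hG.mul_majorant_deriv_le hφ ht.1.le (ht.2.trans h1)).trans
      (mul_le_mul_of_nonneg_right (hle t ht) (majorant_nonneg ht.1.le))
  have hanti : AntitoneOn (fun t => majorant G t * Real.exp (-J t)) (Icc 0 s) := by
    refine antitoneOn_of_deriv_nonpos (convex_Icc _ _) ?_ ?_ ?_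
    · exact ((continuousOn_majorant hG.holo).mono (Icc_subset_Ico_right h1)).mul
        (Real.continuous_exp.comp_continuousOn
          (ContinuousOn.neg fun t ht => (hJ t ht).continuousAt.continuousWithinAt))
    · rw [interior_Icc]
      exact fun t ht => (hderiv t ht).differentiableAt.differentiableWithinAt
    · rw [interior_Icc]
      intro t ht
      rw [(hderiv t ht).deriv]
      nlinarith [hgronwall t ht, Real.exp_pos (-J t)]
  have hend := hanti (left_mem_Icc.2 h0) (right_mem_Icc.2 h0) h0
  simp only [majorant_zero, hG.at_zero, norm_one, hJ0, neg_zero, Real.exp_zero, mul_one,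
    Real.exp_neg, ← div_eq_mul_inv] at hend
  exact (div_le_one (Real.exp_pos _)).1 hend

theorem majorant_le_mul_exp (hG : IsLogDerivSolution φ G) (hne : ∀ z ∈ unitDisk, G z ≠ 0)
    (hH : IsLogDerivSolution (fun z => φ (w z)) H) (hw : IsSchwarzFun w)
    (hφ : DifferentiableOn ℂ φ unitDisk) (hφp : ∀ n, ‖taylorCoeff φ n‖ ≤ n * p)
    (h0 : 0 ≤ s) (h1 : s ≤ 1 / 3) :
    majorant H s ≤ majorant G (‖deriv w 0‖ * s) *
      Real.exp (2 * (1 - ‖deriv w 0‖) * p * growthExponent s) := by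
  have hs1 : s < 1 := by linarith
  have hc := hw.norm_deriv_le_one
  have hGc := hG.comp_const_mul hc
  have hnec : ∀ z ∈ unitDisk, G (deriv w 0 * z) ≠ 0 := fun z hz => hne _ (mul_mem_unitDisk hc hz)
  have hE := hH.div hGc hnec
  have hquot : majorant (fun z => H z / G (deriv w 0 * z)) s ≤
      Real.exp (2 * (1 - ‖deriv w 0‖) * p * growthExponent s) :=
    hE.majorant_le_exp (J := fun s => 2 * (1 - ‖deriv w 0‖) * p * growthExponent s)
      ((hw.differentiableOn_comp hφ).fun_sub (differentiableOn_comp_const_mul hφ hc)) h0 hs1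
      (by simp only [growthExponent_zero, mul_zero])
      (fun t ht => (hasDerivAt_growthExponent (ht.2.trans_lt hs1)).const_mul _)
      (fun t ht => hw.majorant_comp_sub_comp_mul_le hφ hφp ht.1 (ht.2.le.trans h1))
  have hfactor : EqOn H (fun z => G (deriv w 0 * z) * (H z / G (deriv w 0 * z))) unitDisk :=
    fun z hz => (mul_div_cancel₀ (H z) (hnec z hz)).symm
  rw [majorant_congr hfactor, ← majorant_comp_const_mul hG.holo hc]
  exact (majorant_mul_le hGc.holo hE.holo h0 hs1).trans
    (mul_le_mul_of_nonneg_left hquot (majorant_nonneg h0))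

theorem majorant_eq_add_tsum (hG : IsLogDerivSolution φ G) (h0 : 0 ≤ s) (h1 : s < 1) :
    majorant G s = 1 + ‖deriv G 0‖ * s + ∑' n : ℕ, ‖taylorCoeff G (n + 2)‖ * s ^ (n + 2) := by
  rw [majorant, ← (summable_norm_taylorCoeff_mul_pow hG.holo h0 h1).sum_add_tsum_nat_add 2,
    Finset.sum_range_succ, Finset.sum_range_one, taylorCoeff_zero, hG.at_zero, taylorCoeff_one,
    norm_one, pow_zero, pow_one, mul_one]

theorem majorant_sub_majorant_le (hG : IsLogDerivSolution φ G) (hne : ∀ z ∈ unitDisk, G z ≠ 0)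
    (hH : IsLogDerivSolution (fun z => φ (w z)) H) (hw : IsSchwarzFun w)
    (hφ : DifferentiableOn ℂ φ unitDisk) (hφ1 : ‖deriv φ 0‖ ≤ 2)
    (hφn : ∀ n, ‖taylorCoeff φ n‖ ≤ n * ‖deriv φ 0‖) (h0 : 0 ≤ s) (h1 : s ≤ 1 / 3) :
    majorant H s - majorant G s ≤
      (1 - ‖deriv w 0‖) * ‖deriv φ 0‖ * (growthPolynomial s - s) := by
  have hs1 : s < 1 := by linarith
  set c := ‖deriv w 0‖
  have hc1 : c ≤ 1 := hw.norm_deriv_le_one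
  have hc0 : 0 ≤ c := norm_nonneg _
  have hcs0 : 0 ≤ c * s := by positivity
  have hcs1 : c * s < 1 := (mul_le_of_le_one_left h0 hc1).trans_lt hs1
  refine (sub_le_sub_right (hG.majorant_le_mul_exp hne hH hw hφ hφn h0 h1) _).trans ?_
  rw [hG.majorant_eq_add_tsum h0 hs1, hG.deriv_eq hφ]
  refine mul_exp_growthExponent_sub_le h0 h1 hc0 hc1 (norm_nonneg _) hφ1
    (tsum_nonneg fun _ => by positivity) ?_
  rw [hG.majorant_eq_add_tsum hcs0 hcs1, hG.deriv_eq hφ, ← tsum_mul_left]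
  refine add_le_add_right (Summable.tsum_le_tsum (fun n => ?_)
    ((summable_nat_add_iff 2).2 (summable_norm_taylorCoeff_mul_pow hG.holo hcs0 hcs1))
    (((summable_nat_add_iff 2).2 (summable_norm_taylorCoeff_mul_pow hG.holo h0 hs1)).mul_left _)) _
  rw [mul_pow, mul_left_comm]
  exact mul_le_mul_of_nonneg_right (pow_le_pow_of_le_one hc0 hc1 (Nat.le_add_left 2 n))
    (by positivity)

theorem majorant_le_majorant {f f₀ : ℂ → ℂ} {r : ℝ} (hf₀ : DifferentiableOn ℂ f₀ unitDisk)
    (hG : IsLogDerivSolution φ (deriv f₀)) (hne : ∀ z ∈ unitDisk, deriv f₀ z ≠ 0)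
    (hf : DifferentiableOn ℂ f unitDisk) (hH : IsLogDerivSolution (fun z => φ (w z)) (deriv f))
    (hzero : f 0 = f₀ 0) (hw : IsSchwarzFun w) (hφ : DifferentiableOn ℂ φ unitDisk)
    (hφ1 : ‖deriv φ 0‖ ≤ 2) (hφn : ∀ n, ‖taylorCoeff φ n‖ ≤ n * ‖deriv φ 0‖)
    (h0 : 0 ≤ r) (h1 : r ≤ 1 / 3) : majorant f r ≤ majorant f₀ r := by
  have hr1 : r < 1 := by linarith
  have hintH := intervalIntegrable_majorant hH.holo h0 hr1
  have hintG := intervalIntegrable_majorant hG.holo h0 hr1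
  have hdiff :
      (∫ u in (0 : ℝ)..r, majorant (deriv f) u) - ∫ u in (0 : ℝ)..r, majorant (deriv f₀) u ≤
        ∫ u in (0 : ℝ)..r, (1 - ‖deriv w 0‖) * ‖deriv φ 0‖ * (growthPolynomial u - u) := by
    rw [← intervalIntegral.integral_sub hintH hintG]
    exact intervalIntegral.integral_mono_on h0 (hintH.sub hintG)
      (((continuous_growthPolynomial.sub continuous_id).const_mul _).intervalIntegrable _ _)
      fun u hu => hG.majorant_sub_majorant_le hne hH hw hφ hφ1 hφn hu.1 (hu.2.trans h1)
  rw [intervalIntegral.integral_const_mul] at hdiff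
  have hcoef : 0 ≤ (1 - ‖deriv w 0‖) * ‖deriv φ 0‖ :=
    mul_nonneg (sub_nonneg.2 hw.norm_deriv_le_one) (norm_nonneg _)
  rw [majorant_eq_integral hf h0 hr1, majorant_eq_integral hf₀ h0 hr1, hzero]
  linarith [mul_nonpos_of_nonneg_of_nonpos hcoef (integral_growthPolynomial_sub_nonpos h0 h1)]

end IsLogDerivSolution

end Comparison

/-! ### Univalent functions -/

section Univalent

variable {f F G : ℂ → ℂ} {U : Set ℂ} {a : ℂ}

theorem isPreconnected_unitDisk : IsPreconnected unitDisk := (convex_ball _ _).isPreconnected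

theorem not_eventually_const_of_injOn (hi : InjOn f U) (ha : U ∈ 𝓝 a) :
    ¬ ∀ᶠ z in 𝓝 a, f z = f a := by
  intro hconst
  have heq : ∀ᶠ z in 𝓝 a, z = a := by
    filter_upwards [hconst, ha] with z hz hzU using hi hzU (mem_of_mem_nhds ha) hz
  obtain ⟨z, hz, hza⟩ := ((heq.filter_mono nhdsWithin_le_nhds).and
    (self_mem_nhdsWithin : {a}ᶜ ∈ 𝓝[≠] a)).exists
  exact hza hz

theorem image_mem_nhds_of_injOn (hf : AnalyticAt ℂ f a) (hi : InjOn f U) (ha : U ∈ 𝓝 a)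
    {V : Set ℂ} (hV : V ∈ 𝓝 a) : f '' V ∈ 𝓝 (f a) :=
  hf.eventually_constant_or_nhds_le_map_nhds.resolve_left (not_eventually_const_of_injOn hi ha)
    (image_mem_map hV)

theorem isOpen_image_of_injOn (hU : IsOpen U) (hf : DifferentiableOn ℂ f U) (hi : InjOn f U) :
    IsOpen (f '' U) := by
  rw [isOpen_iff_mem_nhds]
  rintro _ ⟨a, ha, rfl⟩
  have haU := hU.mem_nhds ha
  exact image_mem_nhds_of_injOn (hf.analyticAt haU) hi haU haU

theorem continuousAt_invFunOn (hf : AnalyticAt ℂ f a) (hi : InjOn f U) (ha : U ∈ 𝓝 a) :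
    ContinuousAt (Function.invFunOn f U) (f a) := by
  intro V hV
  rw [hi.leftInvOn_invFunOn (mem_of_mem_nhds ha)] at hV
  refine mem_map.2 (mem_of_superset (image_mem_nhds_of_injOn hf hi ha (inter_mem hV ha)) ?_)
  rintro _ ⟨x, hx, rfl⟩
  rw [mem_preimage, hi.leftInvOn_invFunOn hx.2]
  exact hx.1

theorem eventually_deriv_ne_zero_of_injOn (hU : IsOpen U) (hf : DifferentiableOn ℂ f U)
    (hi : InjOn f U) (ha : a ∈ U) : ∀ᶠ z in 𝓝[≠] a, deriv f z ≠ 0 := by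
  have haU := hU.mem_nhds ha
  refine (hf.analyticAt haU).deriv.eventually_eq_zero_or_eventually_ne_zero.resolve_left
    fun hzero => not_eventually_const_of_injOn hi haU ?_
  obtain ⟨ε, hε, hball⟩ := Metric.eventually_nhds_iff_ball.1 (hzero.and haU)
  filter_upwards [ball_mem_nhds a hε] with z hz
  exact isOpen_ball.is_const_of_deriv_eq_zero (convex_ball a ε).isPreconnected
    (hf.mono fun x hx => (hball x hx).2) (fun x hx => (hball x hx).1) hz (mem_ball_self hε)

theorem differentiableAt_invFunOn_of_deriv_ne_zero (hf : AnalyticAt ℂ f a) (hi : InjOn f U)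
    (ha : U ∈ 𝓝 a) (hne : deriv f a ≠ 0) :
    DifferentiableAt ℂ (Function.invFunOn f U) (f a) := by
  have hd : HasDerivAt f (deriv f a) (Function.invFunOn f U (f a)) := by
    rw [hi.leftInvOn_invFunOn (mem_of_mem_nhds ha)]
    exact hf.differentiableAt.hasDerivAt
  refine (hd.of_local_left_inverse (continuousAt_invFunOn hf hi ha) hne ?_).differentiableAt
  filter_upwards [image_mem_nhds_of_injOn hf hi ha ha] with y hy
  exact Function.invFunOn_eq hy

/-- Where `f'` could vanish, the inverse is still continuous, so the singularity is removable. -/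
theorem differentiableOn_invFunOn (hU : IsOpen U) (hf : DifferentiableOn ℂ f U)
    (hi : InjOn f U) : DifferentiableOn ℂ (Function.invFunOn f U) (f '' U) := by
  rintro _ ⟨a, ha, rfl⟩
  have haU := hU.mem_nhds ha
  have han := hf.analyticAt haU
  refine (Complex.analyticAt_of_differentiable_on_punctured_nhds_of_continuousAt ?_
    (continuousAt_invFunOn han hi haU)).differentiableAt.differentiableWithinAt
  have hne := eventually_deriv_ne_zero_of_injOn hU hf hi ha
  rw [eventually_nhdsWithin_iff] at hne ⊢
  filter_upwards [image_mem_nhds_of_injOn han hi haU (inter_mem hne haU)] with y hy hya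
  obtain ⟨x, hx, rfl⟩ := hy
  have hxU := hU.mem_nhds hx.2
  exact differentiableAt_invFunOn_of_deriv_ne_zero (hf.analyticAt hxU) hi hxU
    (hx.1 fun hxa => hya (congrArg f hxa))

theorem subordinate_of_mapsTo_image (hG : DifferentiableOn ℂ G unitDisk) (hi : InjOn G unitDisk)
    (hF : DifferentiableOn ℂ F unitDisk) (hzero : F 0 = G 0)
    (hmaps : MapsTo F unitDisk (G '' unitDisk)) : Subordinate F G :=
  ⟨fun z => Function.invFunOn G unitDisk (F z),
    ⟨(differentiableOn_invFunOn isOpen_unitDisk hG hi).comp hF hmaps,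
      fun _ hz => Function.invFunOn_mem (hmaps hz), by
        rw [hzero, hi.leftInvOn_invFunOn zero_mem_unitDisk]⟩,
    fun _ hz => (Function.invFunOn_eq (hmaps hz)).symm⟩

theorem IsSchwarzFun.eq_self_of_deriv_eq_one {w : ℂ → ℂ} (hw : IsSchwarzFun w)
    (hd : deriv w 0 = 1) {z : ℂ} (hz : z ∈ unitDisk) : w z = z := by
  have hmaps : MapsTo w (ball 0 1) (closedBall (w 0) 1) := fun x hx => by
    rw [hw.zero]
    exact ball_subset_closedBall (hw.mapsTo hx)
  simpa only [hw.zero, dslope_same, hd, sub_zero, zero_add, smul_eq_mul, mul_one] using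
    Complex.affine_of_mapsTo_ball_of_norm_dslope_eq_div hw.holo hmaps zero_mem_unitDisk
      (by rw [dslope_same, hd, norm_one, div_one]) hz

theorem Subordinate.eqOn_of_deriv_eq (h : Subordinate F G) (hG : DifferentiableAt ℂ G 0)
    (hne : deriv G 0 ≠ 0) (hd : deriv F 0 = deriv G 0) : EqOn F G unitDisk := by
  obtain ⟨w, hw, hFw⟩ := h
  have hD := unitDisk_mem_nhds zero_mem_unitDisk
  have hcomp : HasDerivAt (fun z => G (w z)) (deriv G 0 * deriv w 0) 0 := by
    refine HasDerivAt.comp (0 : ℂ) ?_ (hw.holo.differentiableAt hD).hasDerivAt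
    rw [hw.zero]
    exact hG.hasDerivAt
  have hloc : F =ᶠ[𝓝 0] fun z => G (w z) := by filter_upwards [hD] with z hz using hFw z hz
  have hw1 : deriv w 0 = 1 :=
    mul_left_cancel₀ hne (by rw [← hcomp.deriv, ← hloc.deriv_eq, hd, mul_one])
  exact fun z hz => by rw [hFw z hz, hw.eq_self_of_deriv_eq_one hw1 hz]

end Univalent

/-! ### The Ma-Minda function -/

section RealDerivatives

variable {g : ℝ → ℝ} {d x : ℝ}

theorem eventually_lt_right_of_hasDerivAt_pos (h : HasDerivAt g d x) (hd : 0 < d) :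
    ∀ᶠ y in 𝓝[>] x, g x < g y := by
  filter_upwards [(h.tendsto_slope.mono_left (nhdsGT_le_nhdsNE x)).eventually (lt_mem_nhds hd),
    self_mem_nhdsWithin] with y hy hxy using (slope_pos_iff_of_le (le_of_lt hxy)).1 hy

theorem eventually_lt_left_of_hasDerivAt_pos (h : HasDerivAt g d x) (hd : 0 < d) :
    ∀ᶠ y in 𝓝[<] x, g y < g x := by
  filter_upwards [(h.tendsto_slope.mono_left (nhdsLT_le_nhdsNE x)).eventually (lt_mem_nhds hd),
    self_mem_nhdsWithin] with y hy hyx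
  rw [slope_comm] at hy
  exact (slope_pos_iff_of_le (le_of_lt hyx)).1 hy

end RealDerivatives

theorem ofReal_mem_unitDisk_of_mem_Ioo {x : ℝ} (hx : x ∈ Ioo (-1 : ℝ) 1) : (x : ℂ) ∈ unitDisk := by
  rw [mem_unitDisk, Complex.norm_real, Real.norm_eq_abs, abs_lt]
  exact hx

theorem neg_mem_Ioo_of_mem_Ico {r : ℝ} (hr : r ∈ Ico (0 : ℝ) 1) : -r ∈ Ioo (-1 : ℝ) 1 :=
  ⟨neg_lt_neg hr.2, (neg_nonpos.2 hr.1).trans_lt zero_lt_one⟩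

theorem differentiableOn_conj_conj {f : ℂ → ℂ} (hf : DifferentiableOn ℂ f unitDisk) :
    DifferentiableOn ℂ (fun z => (starRingEnd ℂ) (f ((starRingEnd ℂ) z))) unitDisk := by
  intro z hz
  have hd := (hf.differentiableAt (unitDisk_mem_nhds (conj_mem_unitDisk hz))).conj_conj
  rw [Complex.conj_conj] at hd
  exact hd.differentiableWithinAt

theorem hasDerivAt_im_mul_I {F : ℂ → ℂ} {F' : ℂ} (h : HasDerivAt F F' 0) :
    HasDerivAt (fun t : ℝ => (F (t * Complex.I)).im) F'.re 0 := by
  have hF : HasDerivAt F F' (((0 : ℝ) : ℂ) * Complex.I) := by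
    rwa [Complex.ofReal_zero, zero_mul]
  have hline : HasDerivAt (fun t : ℝ => (t : ℂ) * Complex.I) (1 * Complex.I) (0 : ℝ) :=
    Complex.ofRealCLM.hasDerivAt.mul_const Complex.I
  refine (Complex.imCLM.hasFDerivAt.comp_hasDerivAt (0 : ℝ)
    (hF.comp (0 : ℝ) hline)).congr_deriv ?_
  rw [one_mul, Complex.imCLM_apply, Complex.mul_I_im]

namespace IsMaMinda

variable {ψ : ℂ → ℂ} {z : ℂ}

theorem differentiableAt_zero (hψ : IsMaMinda ψ) : DifferentiableAt ℂ ψ 0 :=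
  hψ.holo.differentiableAt (unitDisk_mem_nhds zero_mem_unitDisk)

theorem ofReal_re_deriv_zero (hψ : IsMaMinda ψ) : ((deriv ψ 0).re : ℂ) = deriv ψ 0 :=
  Complex.ext (Complex.ofReal_re _) (by rw [Complex.ofReal_im, hψ.deriv_im])

theorem deriv_ne_zero (hψ : IsMaMinda ψ) : deriv ψ 0 ≠ 0 := fun h => by
  have hpos := hψ.deriv_re_pos
  rw [h, Complex.zero_re] at hpos
  exact hpos.false

/-- `conj ∘ ψ ∘ conj` has the same image as `ψ`, hence is subordinate to it, with the same value
and derivative at the origin. -/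
theorem conj_apply (hψ : IsMaMinda ψ) (hz : z ∈ unitDisk) :
    ψ ((starRingEnd ℂ) z) = (starRingEnd ℂ) (ψ z) := by
  have hzero : (starRingEnd ℂ) (ψ ((starRingEnd ℂ) 0)) = ψ 0 := by
    rw [map_zero, hψ.at_zero, map_one]
  have hderiv : deriv (fun z => (starRingEnd ℂ) (ψ ((starRingEnd ℂ) z))) 0 = deriv ψ 0 := by
    have hd := hψ.differentiableAt_zero.hasDerivAt.conj_conj
    rw [map_zero] at hd
    refine hd.deriv.trans ?_
    rw [← hψ.ofReal_re_deriv_zero, Complex.conj_ofReal]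
  have hsub := subordinate_of_mapsTo_image hψ.holo hψ.univalent (differentiableOn_conj_conj hψ.holo)
    hzero fun z hz => hψ.symm _ (mem_image_of_mem _ (conj_mem_unitDisk hz))
  simpa only [Complex.conj_conj] using (hsub.eqOn_of_deriv_eq hψ.differentiableAt_zero
    hψ.deriv_ne_zero hderiv (conj_mem_unitDisk hz)).symm

theorem im_eq_zero_of_im_apply_eq_zero (hψ : IsMaMinda ψ) (hz : z ∈ unitDisk)
    (h : (ψ z).im = 0) : z.im = 0 := by
  refine Complex.conj_eq_iff_im.1 (hψ.univalent (conj_mem_unitDisk hz) hz ?_)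
  rw [hψ.conj_apply hz, Complex.conj_eq_iff_im.2 h]

theorem ofReal_re_apply (hψ : IsMaMinda ψ) {x : ℝ} (hx : x ∈ Ioo (-1 : ℝ) 1) :
    ((ψ x).re : ℂ) = ψ x := by
  have hconj := hψ.conj_apply (ofReal_mem_unitDisk_of_mem_Ioo hx)
  rw [Complex.conj_ofReal] at hconj
  exact Complex.conj_eq_iff_re.1 hconj.symm

theorem im_nonneg_of_im_pos (hψ : IsMaMinda ψ) (hz : z ∈ unitDisk) (hpos : 0 < z.im) :
    0 ≤ (ψ z).im := by
  by_contra! hneg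
  set U : Set ℂ := unitDisk ∩ {z | 0 < z.im}
  have hU : IsPreconnected U :=
    ((convex_ball (0 : ℂ) 1).inter (convex_halfSpace_im_gt 0)).isPreconnected
  obtain ⟨t, ht, ht0⟩ := ((eventually_lt_right_of_hasDerivAt_pos
    (hasDerivAt_im_mul_I hψ.differentiableAt_zero.hasDerivAt) hψ.deriv_re_pos).and
    (Ioo_mem_nhdsGT (zero_lt_one' ℝ))).exists
  rw [Complex.ofReal_zero, zero_mul, hψ.at_zero, Complex.one_im] at ht
  have htU : (t : ℂ) * Complex.I ∈ U := by
    refine ⟨?_, by simpa using ht0.1⟩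
    rw [mem_unitDisk, norm_mul, Complex.norm_I, Complex.norm_real, mul_one,
      Real.norm_of_nonneg ht0.1.le]
    exact ht0.2
  obtain ⟨x, hxU, hx⟩ := hU.intermediate_value₂ ⟨hz, hpos⟩ htU
    (f := fun z => (ψ z).im) (g := fun _ => 0)
    (Complex.continuous_im.comp_continuousOn (hψ.holo.continuousOn.mono inter_subset_left))
    continuousOn_const hneg.le ht.le
  exact hxU.2.ne' (hψ.im_eq_zero_of_im_apply_eq_zero hxU.1 hx)

theorem im_mul_im_nonneg (hψ : IsMaMinda ψ) (hz : z ∈ unitDisk) : 0 ≤ (ψ z).im * z.im := by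
  rcases lt_trichotomy z.im 0 with hneg | hzero | hpos
  · have hconj := hψ.im_nonneg_of_im_pos (conj_mem_unitDisk hz)
      (by rwa [Complex.conj_im, neg_pos])
    rw [hψ.conj_apply hz, Complex.conj_im, neg_nonneg] at hconj
    exact mul_nonneg_of_nonpos_of_nonpos hconj hneg.le
  · rw [hzero, mul_zero]
  · exact mul_nonneg (hψ.im_nonneg_of_im_pos hz hpos) hpos.le

theorem strictMonoOn (hψ : IsMaMinda ψ) :
    StrictMonoOn (fun x : ℝ => (ψ x).re) (Ioo (-1) 1) := by
  have hc : ContinuousOn (fun x : ℝ => (ψ x).re) (Ioo (-1) 1) :=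
    Complex.continuous_re.comp_continuousOn (hψ.holo.continuousOn.comp
      Complex.continuous_ofReal.continuousOn fun x hx => ofReal_mem_unitDisk_of_mem_Ioo hx)
  have hi : InjOn (fun x : ℝ => (ψ x).re) (Ioo (-1) 1) := fun x hx y hy hxy => by
    refine Complex.ofReal_injective (hψ.univalent (ofReal_mem_unitDisk_of_mem_Ioo hx)
      (ofReal_mem_unitDisk_of_mem_Ioo hy) ?_)
    rw [← hψ.ofReal_re_apply hx, ← hψ.ofReal_re_apply hy]
    exact congrArg _ hxy
  refine (hc.strictMonoOn_of_injOn_Ioo (by norm_num) hi).resolve_right fun hanti => ?_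
  have hd : HasDerivAt (fun t : ℝ => (ψ t).re) (deriv ψ 0).re 0 :=
    HasDerivAt.real_of_complex (by simpa using hψ.differentiableAt_zero.hasDerivAt)
  obtain ⟨t, ht, ht0⟩ := ((eventually_lt_right_of_hasDerivAt_pos hd hψ.deriv_re_pos).and
    (Ioo_mem_nhdsGT (zero_lt_one' ℝ))).exists
  exact ht.not_gt (hanti (by norm_num) ⟨by linarith [ht0.1], ht0.2⟩ ht0.1)

theorem re_apply_neg_le_of_im_eq_zero (hψ : IsMaMinda ψ) {r : ℝ} (hr : r ∈ Ico (0 : ℝ) 1)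
    (hz : ‖z‖ ≤ r) (him : (ψ z).im = 0) : (ψ ((-r : ℝ) : ℂ)).re ≤ (ψ z).re := by
  have hzD : z ∈ unitDisk := mem_unitDisk.2 (hz.trans_lt hr.2)
  have hreal : ((z.re : ℝ) : ℂ) = z :=
    Complex.conj_eq_iff_re.1 (Complex.conj_eq_iff_im.2 (hψ.im_eq_zero_of_im_apply_eq_zero hzD him))
  have hre := (Complex.abs_re_le_norm z).trans hz
  have hle := hψ.strictMonoOn.monotoneOn (neg_mem_Ioo_of_mem_Ico hr)
    (abs_lt.1 (hre.trans_lt hr.2)) (abs_le.1 hre).1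
  rwa [hreal] at hle

theorem re_apply_neg_le_one (hψ : IsMaMinda ψ) {r : ℝ} (hr : r ∈ Ico (0 : ℝ) 1) :
    (ψ ((-r : ℝ) : ℂ)).re ≤ 1 := by
  have hle := hψ.re_apply_neg_le_of_im_eq_zero hr (z := 0) (by rw [norm_zero]; exact hr.1)
    (by rw [hψ.at_zero, Complex.one_im])
  rwa [hψ.at_zero, Complex.one_re] at hle

theorem differentiableOn_sub_one (hψ : IsMaMinda ψ) :
    DifferentiableOn ℂ (fun z => ψ z - 1) unitDisk := hψ.holo.sub (differentiableOn_const _)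

theorem norm_deriv_le_two (hψ : IsMaMinda ψ) : ‖deriv ψ 0‖ ≤ 2 := by
  have h := norm_taylorCoeff_le_of_re_nonneg hψ.holo (fun z hz => (hψ.re_pos z hz).le) one_ne_zero
  rwa [taylorCoeff_one, hψ.at_zero, Complex.one_re, mul_one] at h

theorem norm_taylorCoeff_sub_one_le (hψ : IsMaMinda ψ) :
    ∀ n, ‖taylorCoeff (fun z => ψ z - 1) n‖ ≤ n * ‖deriv ψ 0‖
  | 0 => by rw [taylorCoeff_zero, hψ.at_zero, sub_self, norm_zero, Nat.cast_zero, zero_mul]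
  | n + 1 => by
    have h := norm_taylorCoeff_le_of_typicallyReal hψ.differentiableOn_sub_one
      (fun z hz => by rw [hψ.conj_apply hz, map_sub, map_one])
      (fun z hz => by simpa using hψ.im_mul_im_nonneg hz) n
    rw [taylorCoeff_one, deriv_sub_const] at h
    rw [Nat.cast_succ]
    exact h.trans (by gcongr; exact Complex.re_le_norm _)

end IsMaMinda

/-! ### A minimum principle in polar coordinates -/

section Polar

variable {F : ℂ → ℂ} {F' z : ℂ} {q q' : ℝ → ℝ} {u A R : ℂ → ℝ} {m : ℝ}

theorem norm_mul_exp_mul_I (z : ℂ) (θ : ℝ) : ‖z * Complex.exp (θ * Complex.I)‖ = ‖z‖ := by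
  rw [norm_mul, Complex.norm_exp_ofReal_mul_I, mul_one]

theorem closedBall_norm_subset_unitDisk (hz : z ∈ unitDisk) : closedBall 0 ‖z‖ ⊆ unitDisk :=
  closedBall_subset_ball (mem_unitDisk.1 hz)

theorem norm_mem_Ico (hz : z ∈ unitDisk) : ‖z‖ ∈ Ico (0 : ℝ) 1 :=
  ⟨norm_nonneg z, mem_unitDisk.1 hz⟩

theorem norm_mem_Ioo (hz : z ∈ unitDisk) (hz0 : z ≠ 0) : ‖z‖ ∈ Ioo (0 : ℝ) 1 :=
  ⟨norm_pos_iff.2 hz0, mem_unitDisk.1 hz⟩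

/-- A minimum of `u` over the disk of radius `‖z‖` lying below the level `m` would be a critical
point of the angular variable at which `u` does not increase radially. -/
theorem lt_of_polar_critical (hc : ContinuousOn u unitDisk)
    (hA : ∀ z ∈ unitDisk, z ≠ 0 →
      HasDerivAt (fun θ : ℝ => u (z * Complex.exp (θ * Complex.I))) (A z) 0)
    (hR : ∀ z ∈ unitDisk, z ≠ 0 → HasDerivAt (fun t : ℝ => u (t * z)) (R z) 1)
    (h0 : m < u 0) (h : ∀ z ∈ unitDisk, z ≠ 0 → u z ≤ m → A z = 0 → 0 < R z)
    (hz : z ∈ unitDisk) : m < u z := by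
  by_contra! hle
  have hsub := closedBall_norm_subset_unitDisk hz
  have hzmem : z ∈ closedBall (0 : ℂ) ‖z‖ := mem_closedBall_zero_iff.2 le_rfl
  obtain ⟨x, hx, hmin⟩ := (isCompact_closedBall (0 : ℂ) ‖z‖).exists_isMinOn ⟨z, hzmem⟩
    (hc.mono hsub)
  have hxD := hsub hx
  have hxm : u x ≤ m := (hmin hzmem).trans hle
  have hx0 : x ≠ 0 := by
    rintro rfl
    exact hxm.not_gt h0
  have hAx : A x = 0 := by
    refine IsLocalMin.hasDerivAt_eq_zero (Eventually.of_forall fun θ => ?_) (hA x hxD hx0)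
    rw [Complex.ofReal_zero, zero_mul, Complex.exp_zero, mul_one]
    refine hmin ?_
    rwa [mem_closedBall_zero_iff, norm_mul_exp_mul_I, ← mem_closedBall_zero_iff]
  obtain ⟨t, hlt, ht0, ht1⟩ := ((eventually_lt_left_of_hasDerivAt_pos (hR x hxD hx0)
    (h x hxD hx0 hxm hAx)).and (Ioo_mem_nhdsLT (zero_lt_one' ℝ))).exists
  rw [Complex.ofReal_one, one_mul] at hlt
  refine hlt.not_ge (hmin ?_)
  rw [mem_closedBall_zero_iff, norm_mul, Complex.norm_real, Real.norm_of_nonneg ht0.le]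
  exact (mul_le_of_le_one_left (norm_nonneg x) ht1.le).trans (mem_closedBall_zero_iff.1 hx)

theorem hasDerivAt_comp_rotation (h : HasDerivAt F F' z) :
    HasDerivAt (fun θ : ℝ => F (z * Complex.exp (θ * Complex.I))) (z * F' * Complex.I) 0 := by
  have hrot : HasDerivAt (fun θ : ℝ => z * Complex.exp (θ * Complex.I)) (z * Complex.I)
      (0 : ℝ) := by
    simpa using ((Complex.ofRealCLM.hasDerivAt (x := (0 : ℝ))).mul_const Complex.I).cexp.const_mul z
  refine (HasDerivAt.comp (0 : ℝ) (h₂ := F) (h₂' := F') ?_ hrot).congr_deriv (by ring)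
  rwa [Complex.ofReal_zero, zero_mul, Complex.exp_zero, mul_one]

theorem hasDerivAt_ofReal_mul (z : ℂ) : HasDerivAt (fun t : ℝ => (t : ℂ) * z) z 1 := by
  simpa using (Complex.ofRealCLM.hasDerivAt (x := (1 : ℝ))).mul_const z

theorem hasDerivAt_comp_radial (h : HasDerivAt F F' z) :
    HasDerivAt (fun t : ℝ => F (t * z)) (z * F') 1 := by
  refine (HasDerivAt.comp (1 : ℝ) (h₂ := F) (h₂' := F') ?_
    (hasDerivAt_ofReal_mul z)).congr_deriv (mul_comm _ _)
  rwa [Complex.ofReal_one, one_mul]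

theorem hasDerivAt_re_of_hasDerivAt {γ : ℝ → ℂ} {γ' : ℂ} {t : ℝ} (h : HasDerivAt γ γ' t) :
    HasDerivAt (fun t => (γ t).re) γ'.re t :=
  Complex.reCLM.hasFDerivAt.comp_hasDerivAt t h

theorem hasDerivAt_norm_of_hasDerivAt {γ : ℝ → ℂ} {γ' : ℂ} {t : ℝ} (h : HasDerivAt γ γ' t)
    (hne : γ t ≠ 0) : HasDerivAt (fun t => ‖γ t‖) (‖γ t‖ * (γ' / γ t).re) t := by
  have hn : ‖γ t‖ ≠ 0 := norm_ne_zero_iff.2 hne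
  have hsqrt := h.norm_sq.sqrt (pow_ne_zero 2 hn)
  simp only [Real.sqrt_sq (norm_nonneg _)] at hsqrt
  have hinner : Inner.inner ℝ (γ t) γ' = ‖γ t‖ ^ 2 * (γ' / γ t).re := by
    have hns : Complex.normSq (γ t) ≠ 0 := Complex.normSq_eq_zero.not.2 hne
    rw [Complex.inner, Complex.div_re, ← Complex.normSq_eq_norm_sq, Complex.mul_re,
      Complex.conj_re, Complex.conj_im]
    field_simp
    ring
  refine hsqrt.congr_deriv ?_
  rw [hinner]
  field_simp

theorem hasDerivAt_norm_comp_rotation (h : HasDerivAt F F' z) (hne : F z ≠ 0) :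
    HasDerivAt (fun θ : ℝ => ‖F (z * Complex.exp (θ * Complex.I))‖)
      (-(‖F z‖ * (z * F' / F z).im)) 0 := by
  have hval : F (z * Complex.exp ((0 : ℝ) * Complex.I)) = F z := by
    rw [Complex.ofReal_zero, zero_mul, Complex.exp_zero, mul_one]
  refine (hasDerivAt_norm_of_hasDerivAt (hasDerivAt_comp_rotation h)
    (by rwa [hval])).congr_deriv ?_
  rw [hval, mul_div_right_comm, Complex.mul_I_re, mul_neg]

theorem hasDerivAt_norm_comp_radial (h : HasDerivAt F F' z) (hne : F z ≠ 0) :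
    HasDerivAt (fun t : ℝ => ‖F (t * z)‖) (‖F z‖ * (z * F' / F z).re) 1 := by
  have hval : F ((1 : ℝ) * z) = F z := by rw [Complex.ofReal_one, one_mul]
  refine (hasDerivAt_norm_of_hasDerivAt (hasDerivAt_comp_radial h)
    (by rwa [hval])).congr_deriv ?_
  rw [hval]

theorem hasDerivAt_radial_comp_norm {d : ℝ} (h : HasDerivAt q d ‖z‖) :
    HasDerivAt (fun t : ℝ => q ‖(t : ℂ) * z‖) (d * ‖z‖) 1 := by
  have hline : HasDerivAt (fun t : ℝ => t * ‖z‖) ‖z‖ 1 := by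
    simpa using (hasDerivAt_id' (1 : ℝ)).mul_const ‖z‖
  refine (HasDerivAt.comp (1 : ℝ) (h₂ := q) (h₂' := d) (by rwa [one_mul])
    hline).congr_of_eventuallyEq ?_
  filter_upwards [lt_mem_nhds (zero_lt_one' ℝ)] with t ht
  rw [norm_mul, Complex.norm_real, Real.norm_of_nonneg ht.le, Function.comp_apply]

/-- The perturbation `q r - ε r` makes the radial inequality strict. -/
theorem le_of_polar_critical (hc : ContinuousOn u unitDisk)
    (hA : ∀ z ∈ unitDisk, z ≠ 0 →
      HasDerivAt (fun θ : ℝ => u (z * Complex.exp (θ * Complex.I))) (A z) 0)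
    (hR : ∀ z ∈ unitDisk, z ≠ 0 → HasDerivAt (fun t : ℝ => u (t * z)) (R z) 1)
    (hqc : ContinuousOn q (Ico 0 1)) (hq : ∀ r ∈ Ioo (0 : ℝ) 1, HasDerivAt q (q' r) r)
    (h0 : q 0 ≤ u 0)
    (h : ∀ z ∈ unitDisk, z ≠ 0 → u z ≤ q ‖z‖ → A z = 0 → q' ‖z‖ * ‖z‖ ≤ R z)
    (hz : z ∈ unitDisk) : q ‖z‖ ≤ u z := by
  have hlt (ε : ℝ) (hε : 0 < ε) : -ε < u z - (q ‖z‖ - ε * ‖z‖) := by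
    refine lt_of_polar_critical (u := fun x => u x - (q ‖x‖ - ε * ‖x‖)) (A := A)
      (R := fun x => R x - (q' ‖x‖ - ε) * ‖x‖)
      (hc.sub ((hqc.comp continuous_norm.continuousOn fun x hx => norm_mem_Ico hx).sub
        (continuous_const.mul continuous_norm).continuousOn))
      (fun x hx hx0 => ?_) (fun x hx hx0 => ?_) ?_ (fun x hx hx0 hle hAx => ?_) hz
    · simp only [norm_mul_exp_mul_I]
      exact (hA x hx hx0).sub_const _
    · refine (hR x hx hx0).fun_sub (hasDerivAt_radial_comp_norm (q := fun r => q r - ε * r) ?_)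
      simpa using (hq _ (norm_mem_Ioo hx hx0)).fun_sub ((hasDerivAt_id' ‖x‖).const_mul ε)
    · rw [norm_zero]
      linarith
    · have hεx : 0 < ε * ‖x‖ := mul_pos hε (norm_pos_iff.2 hx0)
      have hRx := h x hx hx0 (by linarith) hAx
      linarith
  refine le_of_forall_pos_le_add fun ε hε => ?_
  have hz1 : ε / 2 * ‖z‖ ≤ ε / 2 := mul_le_of_le_one_right (by positivity) (mem_unitDisk.1 hz).le
  linarith [hlt (ε / 2) (by positivity)]

end Polar

/-! ### The extremal function -/

section Extremal

variable {φ ψ f f₀ : ℂ → ℂ}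

theorem convexQuotient_eq_iff {z q : ℂ} (hne : deriv f z ≠ 0) :
    convexQuotient f z = q ↔ z * deriv (deriv f) z = (q - 1) * deriv f z := by
  rw [convexQuotient, ← div_eq_iff hne, eq_sub_iff_add_eq, add_comm]

theorem IsNormalized.isLogDerivSolution (hf : IsNormalized f)
    (hne : ∀ z ∈ unitDisk, deriv f z ≠ 0) (hq : ∀ z ∈ unitDisk, convexQuotient f z = φ z) :
    IsLogDerivSolution (fun z => φ z - 1) (deriv f) where
  holo := hf.holo.deriv isOpen_unitDisk
  at_zero := hf.deriv_zero
  eqn z hz := (convexQuotient_eq_iff (hne z hz)).1 (hq z hz)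

theorem eq_of_forall_mul_deriv_eq_zero (hf : DifferentiableOn ℂ f unitDisk)
    (h : ∀ z ∈ unitDisk, z * deriv f z = 0) {z : ℂ} (hz : z ∈ unitDisk) : f z = f 0 := by
  have hf' := hf.deriv isOpen_unitDisk
  have hcoeff : ∀ n, taylorCoeff (deriv f) n = 0 := fun n => by
    rw [← taylorCoeff_id_mul_succ hf', taylorCoeff_congr (g := fun _ => 0) h, taylorCoeff_const,
      if_neg n.succ_ne_zero]
  have hzero : EqOn (deriv f) 0 unitDisk := fun x hx => by
    have hsum := hasSum_taylorCoeff hf' hx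
    simp only [hcoeff, zero_mul] at hsum
    exact hsum.unique hasSum_zero
  exact isOpen_unitDisk.is_const_of_deriv_eq_zero isPreconnected_unitDisk hf hzero hz
    zero_mem_unitDisk

theorem IsLogDerivSolution.eqOn {G H : ℂ → ℂ} (hH : IsLogDerivSolution φ H)
    (hG : IsLogDerivSolution φ G) (hne : ∀ z ∈ unitDisk, G z ≠ 0) : EqOn H G unitDisk := by
  intro z hz
  have hE := hH.div hG hne
  have hconst := eq_of_forall_mul_deriv_eq_zero hE.holo
    (fun x hx => by rw [hE.eqn x hx, sub_self, zero_mul]) hz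
  rwa [hE.at_zero, div_eq_one_iff_eq (hne z hz)] at hconst

theorem exists_isLogDerivSolution (hφ : DifferentiableOn ℂ φ unitDisk) (h0 : φ 0 = 0) :
    ∃ G, IsLogDerivSolution φ G ∧ ∀ z ∈ unitDisk, G z ≠ 0 := by
  have hκ : DifferentiableOn ℂ (dslope φ 0) unitDisk :=
    (Complex.differentiableOn_dslope (unitDisk_mem_nhds zero_mem_unitDisk)).2 hφ
  obtain ⟨q, hq0, hq⟩ := (DifferentiableOn.isExactOn_ball hκ).with_val_at 0 0
  have hG : ∀ z ∈ unitDisk, HasDerivAt (fun z => Complex.exp (q z))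
      (Complex.exp (q z) * dslope φ 0 z) z := fun z hz => (hq z hz).cexp
  refine ⟨fun z => Complex.exp (q z),
    ⟨fun z hz => (hG z hz).differentiableAt.differentiableWithinAt,
      by rw [hq0, Complex.exp_zero], fun z hz => ?_⟩, fun z _ => Complex.exp_ne_zero _⟩
  have hslope := sub_smul_dslope φ 0 z
  rw [sub_zero, smul_eq_mul, h0, sub_zero] at hslope
  rw [(hG z hz).deriv, ← hslope]
  ring

theorem exists_primitive {G : ℂ → ℂ} (hG : DifferentiableOn ℂ G unitDisk) :
    ∃ f, DifferentiableOn ℂ f unitDisk ∧ f 0 = 0 ∧ EqOn (deriv f) G unitDisk := by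
  obtain ⟨f, hf0, hf⟩ := (DifferentiableOn.isExactOn_ball hG).with_val_at 0 0
  exact ⟨f, fun z hz => (hf z hz).differentiableAt.differentiableWithinAt, hf0,
    fun z hz => (hf z hz).deriv⟩

theorem IsMaMinda.exists_isConvexExtremal (hψ : IsMaMinda ψ) : ∃ f₀, IsConvexExtremal ψ f₀ := by
  obtain ⟨G, hG, hne⟩ := exists_isLogDerivSolution hψ.differentiableOn_sub_one
    (by rw [hψ.at_zero, sub_self])
  obtain ⟨f, hf, hf0, hf'⟩ := exists_primitive hG.holo
  have hne' : ∀ z ∈ unitDisk, deriv f z ≠ 0 := fun z hz => by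
    rw [hf' hz]
    exact hne z hz
  refine ⟨f, ⟨hf, hf0, (hf' zero_mem_unitDisk).trans hG.at_zero⟩, hne', fun z hz => ?_⟩
  rw [convexQuotient_eq_iff (hne' z hz), (hf'.eventuallyEq_of_mem (unitDisk_mem_nhds hz)).deriv_eq,
    hf' hz]
  exact hG.eqn z hz

namespace IsConvexExtremal

theorem isLogDerivSolution (h : IsConvexExtremal ψ f₀) :
    IsLogDerivSolution (fun z => ψ z - 1) (deriv f₀) :=
  h.normalized.isLogDerivSolution h.deriv_ne h.eqn

theorem eqOn (hf : IsConvexExtremal ψ f) (h : IsConvexExtremal ψ f₀) : EqOn f f₀ unitDisk :=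
  isOpen_unitDisk.eqOn_of_deriv_eq isPreconnected_unitDisk hf.normalized.holo h.normalized.holo
    (hf.isLogDerivSolution.eqOn h.isLogDerivSolution h.deriv_ne) zero_mem_unitDisk
    (by rw [hf.normalized.zero, h.normalized.zero])

theorem conj (hψ : IsMaMinda ψ) (h : IsConvexExtremal ψ f₀) :
    IsConvexExtremal ψ (fun z => (starRingEnd ℂ) (f₀ ((starRingEnd ℂ) z))) := by
  have hd : deriv (fun z => (starRingEnd ℂ) (f₀ ((starRingEnd ℂ) z))) =
      fun z => (starRingEnd ℂ) (deriv f₀ ((starRingEnd ℂ) z)) := deriv_conj_conj (f := f₀)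
  have hdd : deriv (fun z => (starRingEnd ℂ) (deriv f₀ ((starRingEnd ℂ) z))) =
      fun z => (starRingEnd ℂ) (deriv (deriv f₀) ((starRingEnd ℂ) z)) :=
    deriv_conj_conj (f := deriv f₀)
  refine ⟨⟨differentiableOn_conj_conj h.normalized.holo, ?_, ?_⟩, fun z hz => ?_, fun z hz => ?_⟩
  · rw [map_zero, h.normalized.zero, map_zero]
  · simp only [hd, map_zero, h.normalized.deriv_zero, map_one]
  · rw [hd, map_ne_zero]
    exact h.deriv_ne _ (conj_mem_unitDisk hz)
  · have heqn := congrArg (starRingEnd ℂ) (h.eqn _ (conj_mem_unitDisk hz))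
    rw [hψ.conj_apply hz, Complex.conj_conj] at heqn
    rw [← heqn, convexQuotient, convexQuotient, hd, hdd]
    simp only [map_add, map_one, map_div₀, map_mul, Complex.conj_conj]

theorem conj_apply (hψ : IsMaMinda ψ) (h : IsConvexExtremal ψ f₀) {z : ℂ}
    (hz : z ∈ unitDisk) : f₀ ((starRingEnd ℂ) z) = (starRingEnd ℂ) (f₀ z) := by
  simpa only [Complex.conj_conj] using h.eqOn (h.conj hψ) (conj_mem_unitDisk hz)

theorem deriv_conj_apply (hψ : IsMaMinda ψ) (h : IsConvexExtremal ψ f₀) {z : ℂ}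
    (hz : z ∈ unitDisk) : deriv f₀ ((starRingEnd ℂ) z) = (starRingEnd ℂ) (deriv f₀ z) := by
  rw [((h.eqOn (h.conj hψ)).eventuallyEq_of_mem
    (unitDisk_mem_nhds (conj_mem_unitDisk hz))).deriv_eq]
  exact (congrFun (deriv_conj_conj (f := f₀)) ((starRingEnd ℂ) z)).trans
    (by simp only [Function.comp_apply, Complex.conj_conj])

theorem ofReal_re_apply (hψ : IsMaMinda ψ) (h : IsConvexExtremal ψ f₀) {x : ℝ}
    (hx : x ∈ Ioo (-1 : ℝ) 1) : ((f₀ x).re : ℂ) = f₀ x := by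
  have hconj := h.conj_apply hψ (ofReal_mem_unitDisk_of_mem_Ioo hx)
  rw [Complex.conj_ofReal] at hconj
  exact Complex.conj_eq_iff_re.1 hconj.symm

theorem ofReal_re_deriv (hψ : IsMaMinda ψ) (h : IsConvexExtremal ψ f₀) {x : ℝ}
    (hx : x ∈ Ioo (-1 : ℝ) 1) : ((deriv f₀ x).re : ℂ) = deriv f₀ x := by
  have hconj := h.deriv_conj_apply hψ (ofReal_mem_unitDisk_of_mem_Ioo hx)
  rw [Complex.conj_ofReal] at hconj
  exact Complex.conj_eq_iff_re.1 hconj.symm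

theorem re_deriv_pos (hψ : IsMaMinda ψ) (h : IsConvexExtremal ψ f₀) {x : ℝ}
    (hx : x ∈ Ioo (-1 : ℝ) 1) : 0 < (deriv f₀ x).re := by
  by_contra! hneg
  have hc : ContinuousOn (fun x : ℝ => (deriv f₀ x).re) (Ioo (-1) 1) :=
    Complex.continuous_re.comp_continuousOn (h.isLogDerivSolution.holo.continuousOn.comp
      Complex.continuous_ofReal.continuousOn fun x hx => ofReal_mem_unitDisk_of_mem_Ioo hx)
  obtain ⟨y, hy, hy0⟩ := isPreconnected_Ioo.intermediate_value₂ hx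
    (b := 0) ⟨by norm_num, by norm_num⟩ hc (g := fun _ => 0) continuousOn_const hneg
    (by rw [Complex.ofReal_zero, h.normalized.deriv_zero, Complex.one_re]; exact zero_le_one)
  refine h.deriv_ne _ (ofReal_mem_unitDisk_of_mem_Ioo hy) ?_
  rw [← h.ofReal_re_deriv hψ hy, hy0, Complex.ofReal_zero]

end IsConvexExtremal

/-- `-f(-r)` for `f` real on the real axis: for the extremal function this is the lower bound in
the growth theorem. -/
noncomputable def negAxis (f : ℂ → ℂ) (r : ℝ) : ℝ := -(f ((-r : ℝ) : ℂ)).re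

/-- The number `-f₀(-1)`, which is the distance from `0` to the boundary of `f₀(𝔻)`. It is
encoded as a supremum over the radius, which is also the radial limit because `-f₀(-r)` increases
with `r`. -/
noncomputable def koebeRadius (f : ℂ → ℂ) : ℝ := sSup (negAxis f '' Ioo 0 1)

theorem negAxis_zero : negAxis f 0 = -(f 0).re := by rw [negAxis, neg_zero, Complex.ofReal_zero]

theorem hasDerivAt_negAxis (hf : DifferentiableOn ℂ f unitDisk) {r : ℝ} (hr : r ∈ Ico (0 : ℝ) 1) :
    HasDerivAt (negAxis f) (deriv f ((-r : ℝ) : ℂ)).re r := by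
  have hd : HasDerivAt (fun x : ℝ => (f x).re) (deriv f ((-r : ℝ) : ℂ)).re (-r) :=
    (hf.differentiableAt (unitDisk_mem_nhds
      (ofReal_mem_unitDisk_of_mem_Ioo (neg_mem_Ioo_of_mem_Ico hr)))).hasDerivAt.real_of_complex
  exact (hd.comp r (hasDerivAt_neg r)).neg.congr_deriv (by ring)

theorem continuousOn_negAxis (hf : DifferentiableOn ℂ f unitDisk) :
    ContinuousOn (negAxis f) (Ico 0 1) :=
  fun _ hr => (hasDerivAt_negAxis hf hr).continuousAt.continuousWithinAt

namespace IsConvexExtremal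

theorem negAxis_zero (h : IsConvexExtremal ψ f₀) : negAxis f₀ 0 = 0 := by
  rw [_root_.negAxis_zero, h.normalized.zero, Complex.zero_re, neg_zero]

theorem negAxis_deriv_zero (h : IsConvexExtremal ψ f₀) : negAxis (deriv f₀) 0 = -1 := by
  rw [_root_.negAxis_zero, h.normalized.deriv_zero, Complex.one_re]

theorem negAxis_deriv_neg (hψ : IsMaMinda ψ) (h : IsConvexExtremal ψ f₀) {r : ℝ}
    (hr : r ∈ Ico (0 : ℝ) 1) : negAxis (deriv f₀) r < 0 :=
  neg_lt_zero.2 (h.re_deriv_pos hψ (neg_mem_Ioo_of_mem_Ico hr))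

theorem hasDerivAt_negAxis_deriv (hψ : IsMaMinda ψ) (h : IsConvexExtremal ψ f₀) {r : ℝ}
    (hr : r ∈ Ioo (0 : ℝ) 1) :
    HasDerivAt (negAxis (deriv f₀))
      (negAxis (deriv f₀) r * (((ψ ((-r : ℝ) : ℂ)).re - 1) / r)) r := by
  have hr' := neg_mem_Ioo_of_mem_Ico (Ioo_subset_Ico_self hr)
  refine (hasDerivAt_negAxis h.isLogDerivSolution.holo (Ioo_subset_Ico_self hr)).congr_deriv ?_
  have heqn := h.isLogDerivSolution.eqn _ (ofReal_mem_unitDisk_of_mem_Ioo hr')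
  rw [← h.ofReal_re_deriv hψ hr', ← hψ.ofReal_re_apply hr', ← Complex.ofReal_one,
    ← Complex.ofReal_sub, ← Complex.ofReal_mul] at heqn
  have hre := congrArg Complex.re heqn
  rw [Complex.re_ofReal_mul, Complex.ofReal_re] at hre
  have hr0 : r ≠ 0 := hr.1.ne'
  rw [negAxis]
  field_simp
  linarith

theorem monotoneOn_negAxis_deriv (hψ : IsMaMinda ψ) (h : IsConvexExtremal ψ f₀) :
    MonotoneOn (negAxis (deriv f₀)) (Ico 0 1) := by
  refine monotoneOn_of_hasDerivWithinAt_nonneg (convex_Ico 0 1)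
    (continuousOn_negAxis h.isLogDerivSolution.holo)
    (f' := fun r => negAxis (deriv f₀) r * (((ψ ((-r : ℝ) : ℂ)).re - 1) / r)) ?_ ?_ <;>
  rw [interior_Ico] <;> intro r hr
  · exact (h.hasDerivAt_negAxis_deriv hψ hr).hasDerivWithinAt
  · have hr' := Ioo_subset_Ico_self hr
    exact mul_nonneg_of_nonpos_of_nonpos (h.negAxis_deriv_neg hψ hr').le
      (div_nonpos_of_nonpos_of_nonneg (sub_nonpos.2 (hψ.re_apply_neg_le_one hr')) hr.1.le)

theorem negAxis_le (hψ : IsMaMinda ψ) (h : IsConvexExtremal ψ f₀) {r : ℝ}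
    (hr : r ∈ Ico (0 : ℝ) 1) : negAxis f₀ r ≤ r := by
  have hd : ∀ x ∈ Ico (0 : ℝ) 1, HasDerivAt (negAxis f₀) (-negAxis (deriv f₀) x) x := fun x hx => by
    rw [negAxis, neg_neg]
    exact hasDerivAt_negAxis h.normalized.holo hx
  have hle := (convex_Ico (0 : ℝ) 1).image_sub_le_mul_sub_of_deriv_le
    (continuousOn_negAxis h.normalized.holo) (C := 1) (by
      rw [interior_Ico]
      exact fun x hx => (hd x (Ioo_subset_Ico_self hx)).differentiableAt.differentiableWithinAt) (by
      rw [interior_Ico]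
      intro x hx
      have hmono := h.monotoneOn_negAxis_deriv hψ (a := 0) (by simp) (Ioo_subset_Ico_self hx)
        hx.1.le
      rw [h.negAxis_deriv_zero] at hmono
      rw [(hd x (Ioo_subset_Ico_self hx)).deriv]
      linarith) 0 (by simp) r hr hr.1
  rwa [h.negAxis_zero, sub_zero, sub_zero, one_mul] at hle

theorem strictMonoOn_negAxis (hψ : IsMaMinda ψ) (h : IsConvexExtremal ψ f₀) :
    StrictMonoOn (negAxis f₀) (Ico 0 1) := by
  refine strictMonoOn_of_deriv_pos (convex_Ico 0 1) (continuousOn_negAxis h.normalized.holo)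
    fun r hr => ?_
  rw [interior_Ico] at hr
  rw [(hasDerivAt_negAxis h.normalized.holo (Ioo_subset_Ico_self hr)).deriv]
  exact h.re_deriv_pos hψ (neg_mem_Ioo_of_mem_Ico (Ioo_subset_Ico_self hr))

theorem bddAbove_image_negAxis (hψ : IsMaMinda ψ) (h : IsConvexExtremal ψ f₀) :
    BddAbove (negAxis f₀ '' Ioo 0 1) :=
  ⟨1, forall_mem_image.2 fun _ hr => (h.negAxis_le hψ (Ioo_subset_Ico_self hr)).trans hr.2.le⟩

theorem negAxis_lt_koebeRadius (hψ : IsMaMinda ψ) (h : IsConvexExtremal ψ f₀) {r : ℝ}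
    (hr : r ∈ Ico (0 : ℝ) 1) : negAxis f₀ r < koebeRadius f₀ := by
  obtain ⟨s, hrs, hs1⟩ := exists_between hr.2
  have hs : s ∈ Ioo (0 : ℝ) 1 := ⟨hr.1.trans_lt hrs, hs1⟩
  exact (h.strictMonoOn_negAxis hψ hr (Ioo_subset_Ico_self hs) hrs).trans_le
    (le_csSup (h.bddAbove_image_negAxis hψ) (mem_image_of_mem _ hs))

theorem koebeRadius_pos (hψ : IsMaMinda ψ) (h : IsConvexExtremal ψ f₀) : 0 < koebeRadius f₀ := by
  have hlt := h.negAxis_lt_koebeRadius hψ (r := 0) (by simp)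
  rwa [h.negAxis_zero] at hlt

theorem koebeRadius_le_one (hψ : IsMaMinda ψ) (h : IsConvexExtremal ψ f₀) :
    koebeRadius f₀ ≤ 1 :=
  csSup_le ((nonempty_Ioo.2 zero_lt_one).image _) (forall_mem_image.2 fun _ hr =>
    (h.negAxis_le hψ (Ioo_subset_Ico_self hr)).trans hr.2.le)

theorem tendsto_negAxis (hψ : IsMaMinda ψ) (h : IsConvexExtremal ψ f₀) :
    Tendsto (negAxis f₀) (𝓝[<] 1) (𝓝 (koebeRadius f₀)) :=
  ((h.strictMonoOn_negAxis hψ).monotoneOn.mono Ioo_subset_Ico_self).tendsto_nhdsWithin_Ioo_left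
    (nonempty_Ioo.2 zero_lt_one) (h.bddAbove_image_negAxis hψ)

theorem tendsto_apply_neg (hψ : IsMaMinda ψ) (h : IsConvexExtremal ψ f₀) :
    Tendsto (fun t : ℝ => f₀ (-(t : ℂ))) (𝓝[<] (1 : ℝ)) (𝓝 (-(koebeRadius f₀ : ℂ))) := by
  refine (((Complex.continuous_ofReal.tendsto _).comp (h.tendsto_negAxis hψ)).neg).congr' ?_
  filter_upwards [Ioo_mem_nhdsLT (zero_lt_one' ℝ)] with t ht
  rw [Function.comp_apply, negAxis, Complex.ofReal_neg, neg_neg,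
    h.ofReal_re_apply hψ (neg_mem_Ioo_of_mem_Ico (Ioo_subset_Ico_self ht)), Complex.ofReal_neg]

end IsConvexExtremal

end Extremal

/-! ### Growth in the class of Ma-Minda convex functions -/

section Growth

variable {ψ f f₀ P : ℂ → ℂ} {z : ℂ}

theorem IsConvexExtremal.isMaMindaConvex (h : IsConvexExtremal ψ f₀) : IsMaMindaConvex ψ f₀ :=
  ⟨h.normalized, h.deriv_ne, fun z => z, ⟨differentiableOn_id, fun _ hz => hz, rfl⟩, h.eqn⟩

theorem IsMaMindaConvex.re_convexQuotient_pos (hψ : IsMaMinda ψ) (hf : IsMaMindaConvex ψ f)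
    (hz : z ∈ unitDisk) : 0 < (convexQuotient f z).re := by
  obtain ⟨w, hw, hwe⟩ := hf.subord
  rw [hwe z hz]
  exact hψ.re_pos _ (hw.mapsTo hz)

/-- At a critical point of the angular variable `z f''/f' = ψ(w) - 1` is real, so `w` is real and
`w ≥ -|z|`, and `ψ` increases along the real axis. -/
theorem IsMaMindaConvex.le_norm_deriv (hψ : IsMaMinda ψ) (h : IsConvexExtremal ψ f₀)
    (hf : IsMaMindaConvex ψ f) (hz : z ∈ unitDisk) : -negAxis (deriv f₀) ‖z‖ ≤ ‖deriv f z‖ := by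
  obtain ⟨w, hw, hwe⟩ := hf.subord
  have hsol := hf.normalized.isLogDerivSolution hf.deriv_ne hwe
  have hd : ∀ x ∈ unitDisk, HasDerivAt (deriv f) (deriv (deriv f) x) x := fun x hx =>
    (hsol.holo.differentiableAt (unitDisk_mem_nhds hx)).hasDerivAt
  refine le_of_polar_critical (q := fun r => -negAxis (deriv f₀) r) hsol.holo.continuousOn.norm
    (fun x hx _ => hasDerivAt_norm_comp_rotation (hd x hx) (hf.deriv_ne x hx))
    (fun x hx _ => hasDerivAt_norm_comp_radial (hd x hx) (hf.deriv_ne x hx))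
    (continuousOn_negAxis h.isLogDerivSolution.holo).neg
    (fun r hr => (h.hasDerivAt_negAxis_deriv hψ hr).neg) ?_ (fun x hx hx0 hle hcrit => ?_) hz
  · rw [h.negAxis_deriv_zero, neg_neg, hf.normalized.deriv_zero, norm_one]
  · have hquot : x * deriv (deriv f) x / deriv f x = ψ (w x) - 1 := by
      rw [hsol.eqn x hx, mul_div_cancel_right₀ _ (hf.deriv_ne x hx)]
    rw [neg_eq_zero, hquot, mul_eq_zero, Complex.sub_im, Complex.one_im, sub_zero] at hcrit
    have hψw := hψ.re_apply_neg_le_of_im_eq_zero (norm_mem_Ico hx) (hw.norm_le hx)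
      (hcrit.resolve_left (norm_ne_zero_iff.2 (hf.deriv_ne x hx)))
    rw [hquot, Complex.sub_re, Complex.one_re, neg_mul, mul_assoc,
      div_mul_cancel₀ _ (norm_ne_zero_iff.2 hx0), ← neg_mul]
    exact (mul_le_mul_of_nonpos_right hle
      (sub_nonpos.2 (hψ.re_apply_neg_le_one (norm_mem_Ico hx)))).trans
      (mul_le_mul_of_nonneg_left (sub_le_sub_right hψw 1) (norm_nonneg _))

/-- Starlikeness `Re (z f'(z) / f(z)) > 0`, written as `f = z f' P` with `Re P > 0` so that no
quotient vanishing at the origin occurs. -/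
structure IsStarlikeWith (P f : ℂ → ℂ) : Prop where
  re_pos : ∀ z ∈ unitDisk, 0 < (P z).re
  eqn : ∀ z ∈ unitDisk, f z = z * deriv f z * P z

theorem mul_convexQuotient_add_mul_deriv (hf : DifferentiableOn ℂ f unitDisk)
    (hP : DifferentiableOn ℂ P unitDisk) (he : ∀ z ∈ unitDisk, f z = z * deriv f z * P z)
    (hz : z ∈ unitDisk) (hne : deriv f z ≠ 0) : P z * convexQuotient f z + z * deriv P z = 1 := by
  have hmem := unitDisk_mem_nhds hz
  have hprod := ((hasDerivAt_id' z).fun_mul ((hf.deriv isOpen_unitDisk).differentiableAt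
    hmem).hasDerivAt).fun_mul (hP.differentiableAt hmem).hasDerivAt
  have hderiv : deriv f z = _ :=
    ((show EqOn f _ unitDisk from he).eventuallyEq_of_mem hmem).deriv_eq.trans hprod.deriv
  rw [convexQuotient]
  field_simp
  linear_combination -hderiv

theorem re_pos_of_mul_add_eq_one {p c d : ℂ} (h : p * c + d = 1) (hc : 0 < c.re) (hd : d.im = 0)
    (hp : p.re ≤ 0) : 0 < d.re := by
  by_contra! hneg
  have hre : p.re * c.re - p.im * c.im + d.re = 1 := congrArg Complex.re h
  have him : p.re * c.im + p.im * c.re + d.im = 0 := congrArg Complex.im h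
  have hpc : 0 < p.re * c.re - p.im * c.im := by linarith
  have hnorm : c.re * (p.re * c.re - p.im * c.im) = p.re * (c.re ^ 2 + c.im ^ 2) := by
    linear_combination -c.im * him + c.im * hd
  nlinarith [mul_pos hc hpc, sq_nonneg c.re, sq_nonneg c.im]

theorem exists_isStarlikeWith_of_convex (hf : IsNormalized f) (hne : ∀ z ∈ unitDisk, deriv f z ≠ 0)
    (hre : ∀ z ∈ unitDisk, 0 < (convexQuotient f z).re) : ∃ P, IsStarlikeWith P f := by
  set P : ℂ → ℂ := fun z => dslope f 0 z / deriv f z with hP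
  have hPd : DifferentiableOn ℂ P unitDisk := ((Complex.differentiableOn_dslope
    (unitDisk_mem_nhds zero_mem_unitDisk)).2 hf.holo).fun_div (hf.holo.deriv isOpen_unitDisk) hne
  have hPe : ∀ z ∈ unitDisk, f z = z * deriv f z * P z := fun z hz => by
    have hslope := sub_smul_dslope f 0 z
    rw [sub_zero, smul_eq_mul, hf.zero, sub_zero] at hslope
    rw [hP, mul_assoc, mul_div_cancel₀ _ (hne z hz), hslope]
  have hd : ∀ x ∈ unitDisk, HasDerivAt P (deriv P x) x := fun x hx =>
    (hPd.differentiableAt (unitDisk_mem_nhds hx)).hasDerivAt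
  refine ⟨P, fun z hz => ?_, hPe⟩
  refine lt_of_polar_critical (u := fun z => (P z).re)
    (Complex.continuous_re.comp_continuousOn hPd.continuousOn)
    (fun x hx _ => hasDerivAt_re_of_hasDerivAt (hasDerivAt_comp_rotation (hd x hx)))
    (fun x hx _ => hasDerivAt_re_of_hasDerivAt (hasDerivAt_comp_radial (hd x hx))) ?_
    (fun x hx _ hPx hcrit => ?_) hz
  · simp only [hP, dslope_same, hf.deriv_zero, div_one, Complex.one_re, zero_lt_one]
  · rw [Complex.mul_I_re, neg_eq_zero] at hcrit
    exact re_pos_of_mul_add_eq_one (mul_convexQuotient_add_mul_deriv hf.holo hPd hPe hx (hne x hx))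
      (hre x hx) hcrit hPx

theorem IsMaMindaConvex.exists_isStarlikeWith (hψ : IsMaMinda ψ) (hf : IsMaMindaConvex ψ f) :
    ∃ P, IsStarlikeWith P f :=
  exists_isStarlikeWith_of_convex hf.normalized hf.deriv_ne fun _ hz =>
    hf.re_convexQuotient_pos hψ hz

namespace IsStarlikeWith

theorem apply_zero (h : IsStarlikeWith P f) : f 0 = 0 := by
  rw [h.eqn 0 zero_mem_unitDisk, zero_mul, zero_mul]

theorem ne_zero (h : IsStarlikeWith P f) (hz : z ∈ unitDisk) : P z ≠ 0 := fun h0 => by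
  have hpos := h.re_pos z hz
  rw [h0, Complex.zero_re] at hpos
  exact hpos.false

theorem apply_ne_zero (h : IsStarlikeWith P f) (hz : z ∈ unitDisk) (hz0 : z ≠ 0)
    (hne : deriv f z ≠ 0) : f z ≠ 0 := by
  rw [h.eqn z hz]
  exact mul_ne_zero (mul_ne_zero hz0 hne) (h.ne_zero hz)

theorem mul_deriv_div (h : IsStarlikeWith P f) (hz : z ∈ unitDisk) (hz0 : z ≠ 0)
    (hne : deriv f z ≠ 0) : z * deriv f z / f z = (P z)⁻¹ := by
  rw [h.eqn z hz, div_mul_cancel_left₀ (mul_ne_zero hz0 hne)]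

/-- A real number `z f'/f` with positive real part equals its modulus. -/
theorem norm_mul_re_eq (h : IsStarlikeWith P f) (hz : z ∈ unitDisk) (hz0 : z ≠ 0)
    (hne : deriv f z ≠ 0) (him : (z * deriv f z / f z).im = 0) :
    ‖f z‖ * (z * deriv f z / f z).re = ‖deriv f z‖ * ‖z‖ := by
  have hpos : 0 ≤ (z * deriv f z / f z).re := by
    rw [h.mul_deriv_div hz hz0 hne, Complex.inv_re]
    exact div_nonneg (h.re_pos z hz).le (Complex.normSq_nonneg _)
  rw [Complex.re_eq_norm.2 ⟨hpos, him.symm⟩, norm_div, norm_mul,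
    mul_div_cancel₀ _ (norm_ne_zero_iff.2 (h.apply_ne_zero hz hz0 hne)), mul_comm]

end IsStarlikeWith

theorem IsMaMindaConvex.le_norm (hψ : IsMaMinda ψ) (h : IsConvexExtremal ψ f₀)
    (hf : IsMaMindaConvex ψ f) (hz : z ∈ unitDisk) : negAxis f₀ ‖z‖ ≤ ‖f z‖ := by
  obtain ⟨P, hP⟩ := hf.exists_isStarlikeWith hψ
  have hd : ∀ x ∈ unitDisk, HasDerivAt f (deriv f x) x := fun x hx =>
    (hf.normalized.holo.differentiableAt (unitDisk_mem_nhds hx)).hasDerivAt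
  have hne : ∀ x ∈ unitDisk, x ≠ 0 → f x ≠ 0 := fun x hx hx0 =>
    hP.apply_ne_zero hx hx0 (hf.deriv_ne x hx)
  refine le_of_polar_critical hf.normalized.holo.continuousOn.norm
    (fun x hx hx0 => hasDerivAt_norm_comp_rotation (hd x hx) (hne x hx hx0))
    (fun x hx hx0 => hasDerivAt_norm_comp_radial (hd x hx) (hne x hx hx0))
    (continuousOn_negAxis h.normalized.holo)
    (fun r hr => hasDerivAt_negAxis h.normalized.holo (Ioo_subset_Ico_self hr)) ?_
    (fun x hx hx0 _ hcrit => ?_) hz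
  · rw [h.negAxis_zero]
    exact norm_nonneg _
  · rw [neg_eq_zero, mul_eq_zero] at hcrit
    rw [hP.norm_mul_re_eq hx hx0 (hf.deriv_ne x hx)
      (hcrit.resolve_left (norm_ne_zero_iff.2 (hne x hx hx0)))]
    refine mul_le_mul_of_nonneg_right ?_ (norm_nonneg x)
    have hle := hf.le_norm_deriv hψ h hx
    rwa [negAxis, neg_neg] at hle

end Growth

/-! ### Univalence of starlike functions -/

section Univalence

variable {f P : ℂ → ℂ}

theorem isCompact_setOf_apply_eq_and_ne {X Y : Type*} [TopologicalSpace X] [TopologicalSpace Y]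
    [T2Space X] [T2Space Y] {s : Set X} {f : X → Y} (hs : IsCompact s) (hf : ContinuousOn f s)
    (hloc : ∀ a ∈ s, ∃ U ∈ 𝓝 a, InjOn f U) :
    IsCompact {p : X × X | p ∈ s ×ˢ s ∧ f p.1 = f p.2 ∧ p.1 ≠ p.2} := by
  choose! U hU hi using hloc
  have hss := hs.prod hs
  have hpair : ContinuousOn (fun p : X × X => (f p.1, f p.2)) (s ×ˢ s) :=
    (hf.comp continuousOn_fst fun _ hp => hp.1).prodMk (hf.comp continuousOn_snd fun _ hp => hp.2)
  have hT : IsCompact (s ×ˢ s ∩ (fun p : X × X => (f p.1, f p.2)) ⁻¹' diagonal Y) :=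
    hss.of_isClosed_subset (hpair.preimage_isClosed_of_isClosed hss.isClosed isClosed_diagonal)
      inter_subset_left
  have hopen : IsOpen (⋃ a ∈ s, interior (U a) ×ˢ interior (U a)) :=
    isOpen_biUnion fun a _ => isOpen_interior.prod isOpen_interior
  convert hT.diff hopen using 1
  ext ⟨x, y⟩
  simp only [mem_ofPred_eq, Set.mem_sdiff, mem_inter_iff, mem_preimage, mem_diagonal_iff,
    mem_iUnion, mem_prod, exists_prop, not_exists, not_and, and_assoc]
  refine and_congr_right fun hx => and_congr_right fun hy => and_congr_right fun hxy => ⟨?_, ?_⟩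
  · exact fun hne a ha hxU hyU =>
      hne (hi a ha (interior_subset hxU) (interior_subset hyU) hxy)
  · rintro hfar rfl
    exact hfar x hx (mem_interior_iff_mem_nhds.2 (hU x hx)) (mem_interior_iff_mem_nhds.2 (hU x hx))

theorem injOn_of_forall_exists_max_norm_lt (hf : ContinuousOn f unitDisk)
    (hloc : ∀ a ∈ unitDisk, ∃ U ∈ 𝓝 a, InjOn f U)
    (h : ∀ a ∈ unitDisk, ∀ b ∈ unitDisk, f a = f b → a ≠ b →
      ∃ a' b', f a' = f b' ∧ a' ≠ b' ∧ max ‖a'‖ ‖b'‖ < max ‖a‖ ‖b‖) : InjOn f unitDisk := by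
  intro a ha b hb hab
  by_contra hne
  set ρ := max ‖a‖ ‖b‖
  have hsub : closedBall (0 : ℂ) ρ ⊆ unitDisk :=
    closedBall_subset_ball (max_lt (mem_unitDisk.1 ha) (mem_unitDisk.1 hb))
  have hK := isCompact_setOf_apply_eq_and_ne (isCompact_closedBall (0 : ℂ) ρ) (hf.mono hsub)
    fun x hx => hloc x (hsub hx)
  have hmem : ∀ x : ℂ × ℂ, x ∈ closedBall (0 : ℂ) ρ ×ˢ closedBall 0 ρ ↔ max ‖x.1‖ ‖x.2‖ ≤ ρ :=
    fun x => by rw [mem_prod, mem_closedBall_zero_iff, mem_closedBall_zero_iff, max_le_iff]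
  obtain ⟨p, ⟨hpρ, hpf, hpne⟩, hmin⟩ := hK.exists_isMinOn
    ⟨(a, b), (hmem _).2 le_rfl, hab, hne⟩ (f := fun p : ℂ × ℂ => max ‖p.1‖ ‖p.2‖) (by fun_prop)
  obtain ⟨a', b', hf', hne', hlt⟩ := h p.1 (hsub hpρ.1) p.2 (hsub hpρ.2) hpf hpne
  have hle := hmin (a := (a', b')) ⟨(hmem _).2 (hlt.le.trans ((hmem _).1 hpρ)), hf', hne'⟩
  exact hlt.not_ge hle

theorem exists_mem_nhds_injOn_of_deriv_ne_zero {a : ℂ} (hf : AnalyticAt ℂ f a)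
    (hne : deriv f a ≠ 0) : ∃ U ∈ 𝓝 a, InjOn f U := by
  have hs := hf.hasStrictDerivAt.hasStrictFDerivAt_equiv hne
  exact ⟨(hs.toOpenPartialHomeomorph f).source,
    (hs.toOpenPartialHomeomorph f).open_source.mem_nhds hs.mem_toOpenPartialHomeomorph_source,
    (hs.toOpenPartialHomeomorph f).injOn⟩

/-- The derivative of `log ‖g(t f(x))‖` at `t = 1`, for the local inverse `g` of `f` near `f(x)`, is
`Re P(x)`: shrinking `f(x)` towards the origin moves `x` towards the origin. -/
theorem IsStarlikeWith.exists_lift_toward_zero (h : IsStarlikeWith P f)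
    (hf : DifferentiableOn ℂ f unitDisk) {x : ℂ} (hx : x ∈ unitDisk) (hx0 : x ≠ 0)
    (hne : deriv f x ≠ 0) :
    ∃ γ : ℝ → ℂ, Tendsto γ (𝓝[<] 1) (𝓝 x) ∧
      ∀ᶠ t in 𝓝[<] (1 : ℝ), f (γ t) = t * f x ∧ ‖γ t‖ < ‖x‖ := by
  have hs := (hf.analyticAt (unitDisk_mem_nhds hx)).hasStrictDerivAt
  set g := hs.localInverse f (deriv f x) x hne
  have hgx : g (f x) = x := (hs.hasStrictFDerivAt_equiv hne).localInverse_apply_image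
  have hfg : ∀ᶠ y in 𝓝 (f x), f (g y) = y :=
    (hs.hasStrictFDerivAt_equiv hne).eventually_right_inverse
  have hline := hasDerivAt_ofReal_mul (f x)
  have hone : ((1 : ℝ) : ℂ) * f x = f x := by rw [Complex.ofReal_one, one_mul]
  have hγ : HasDerivAt (fun t : ℝ => g (t * f x)) ((deriv f x)⁻¹ * f x) 1 :=
    HasDerivAt.comp (1 : ℝ) (h₂ := g) (by rw [hone]; exact (hs.to_localInverse hne).hasDerivAt)
      hline
  have hγ1 : g ((1 : ℝ) * f x) = x := by rw [hone, hgx]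
  have hnorm := hasDerivAt_norm_of_hasDerivAt hγ (by rwa [hγ1])
  have hquot : (deriv f x)⁻¹ * f x / x = P x := by
    rw [h.eqn x hx]
    field_simp
  rw [hγ1, hquot] at hnorm
  have hcloser := eventually_lt_left_of_hasDerivAt_pos hnorm
    (mul_pos (norm_pos_iff.2 hx0) (h.re_pos x hx))
  rw [hγ1] at hcloser
  have htendsto := hγ.continuousAt.tendsto
  have hline_tendsto := hline.continuousAt.tendsto
  rw [hγ1] at htendsto
  rw [hone] at hline_tendsto
  refine ⟨_, htendsto.mono_left nhdsWithin_le_nhds, ?_⟩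
  filter_upwards [hcloser, (hline_tendsto.mono_left nhdsWithin_le_nhds).eventually hfg]
    with t hlt heq using ⟨heq, hlt⟩

theorem IsStarlikeWith.injOn (h : IsStarlikeWith P f) (hf : DifferentiableOn ℂ f unitDisk)
    (hne : ∀ z ∈ unitDisk, deriv f z ≠ 0) : InjOn f unitDisk := by
  have hzero : ∀ x ∈ unitDisk, f x = 0 → x = 0 := fun x hx => by
    contrapose
    exact fun hx0 => h.apply_ne_zero hx hx0 (hne x hx)
  refine injOn_of_forall_exists_max_norm_lt hf.continuousOn (fun a ha =>
    exists_mem_nhds_injOn_of_deriv_ne_zero (hf.analyticAt (unitDisk_mem_nhds ha)) (hne a ha))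
    fun a ha b hb hab hab' => ?_
  have ha0 : a ≠ 0 := by
    rintro rfl
    exact hab' (hzero b hb (by rw [← hab, h.apply_zero])).symm
  have hb0 : b ≠ 0 := by
    rintro rfl
    exact hab' (hzero a ha (by rw [hab, h.apply_zero]))
  obtain ⟨α, hα, hαf⟩ := h.exists_lift_toward_zero hf ha ha0 (hne a ha)
  obtain ⟨β, hβ, hβf⟩ := h.exists_lift_toward_zero hf hb hb0 (hne b hb)
  obtain ⟨t, ⟨⟨hαt, hαlt⟩, hβt, hβlt⟩, hαβ⟩ :=
    ((hαf.and hβf).and ((hα.sub hβ).eventually_ne (sub_ne_zero.2 hab'))).exists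
  exact ⟨α t, β t, by rw [hαt, hβt, hab], sub_ne_zero.1 hαβ, max_lt_max hαlt hβlt⟩

theorem IsMaMindaConvex.injOn {ψ : ℂ → ℂ} (hψ : IsMaMinda ψ) (hf : IsMaMindaConvex ψ f) :
    InjOn f unitDisk := by
  obtain ⟨P, hP⟩ := hf.exists_isStarlikeWith hψ
  exact hP.injOn hf.normalized.holo hf.deriv_ne

end Univalence

/-! ### The distance to the boundary of the image -/

section BoundaryDist

variable {ψ f f₀ : ℂ → ℂ}

theorem image_unitDisk_ne_univ (hf : DifferentiableOn ℂ f unitDisk) (hi : InjOn f unitDisk) :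
    f '' unitDisk ≠ univ := by
  intro huniv
  have hinv := differentiableOn_invFunOn isOpen_unitDisk hf hi
  rw [huniv, differentiableOn_univ] at hinv
  have hbdd : Bornology.IsBounded (range (Function.invFunOn f unitDisk)) :=
    isBounded_ball.subset (range_subset_iff.2 fun b =>
      Function.invFunOn_mem (huniv ▸ mem_univ b : b ∈ f '' unitDisk))
  have hhalf : (2⁻¹ : ℂ) ∈ unitDisk := by
    rw [mem_unitDisk]
    norm_num
  have hconst := hinv.apply_eq_apply_of_bounded hbdd (f 0) (f 2⁻¹)
  rw [hi.leftInvOn_invFunOn zero_mem_unitDisk, hi.leftInvOn_invFunOn hhalf] at hconst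
  norm_num at hconst

theorem le_boundaryDist_of_forall_le_dist (hf : DifferentiableOn ℂ f unitDisk)
    (hi : InjOn f unitDisk) {m r : ℝ} (hr : r < 1)
    (h : ∀ z ∈ unitDisk, r < ‖z‖ → m ≤ dist (f 0) (f z)) : m ≤ boundaryDist f := by
  have hopen := isOpen_image_of_injOn isOpen_unitDisk hf hi
  rw [boundaryDist, le_infDist (nonempty_frontier_iff.2
    ⟨⟨f 0, mem_image_of_mem f zero_mem_unitDisk⟩, image_unitDisk_ne_univ hf hi⟩)]
  intro b hb
  rw [hopen.frontier_eq] at hb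
  by_contra! hlt
  have hsub : closedBall (0 : ℂ) r ⊆ unitDisk := closedBall_subset_ball hr
  have hcompact : IsCompact (f '' closedBall 0 r) :=
    (isCompact_closedBall 0 r).image_of_continuousOn (hf.continuousOn.mono hsub)
  obtain ⟨_, ⟨hy, hy'⟩, x, hx, rfl⟩ := mem_closure_iff.1 hb.1 _
    ((isOpen_ball (x := f 0) (ε := m)).inter hcompact.isClosed.isOpen_compl)
    ⟨mem_ball'.2 hlt, fun hmem => hb.2 (image_mono hsub hmem)⟩
  refine (mem_ball'.1 hy).not_ge (h x hx (lt_of_not_ge fun hle => hy' ?_))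
  exact mem_image_of_mem f (mem_closedBall_zero_iff.2 hle)

theorem mem_frontier_image_of_tendsto {α : Type*} {l : Filter α} [l.NeBot] {γ : α → ℂ} {b : ℂ}
    (hf : DifferentiableOn ℂ f unitDisk) (hi : InjOn f unitDisk) (hγ : ∀ᶠ t in l, γ t ∈ unitDisk)
    (hγ1 : Tendsto (fun t => ‖γ t‖) l (𝓝 1)) (hb : Tendsto (fun t => f (γ t)) l (𝓝 b)) :
    b ∈ frontier (f '' unitDisk) := by
  rw [(isOpen_image_of_injOn isOpen_unitDisk hf hi).frontier_eq]
  refine ⟨mem_closure_of_tendsto hb (hγ.mono fun t ht => mem_image_of_mem f ht), ?_⟩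
  rintro ⟨x, hx, rfl⟩
  obtain ⟨ρ, hxρ, hρ⟩ := exists_between (mem_unitDisk.1 hx)
  have hxU := unitDisk_mem_nhds hx
  have hnhds := image_mem_nhds_of_injOn (hf.analyticAt hxU) hi hxU
    (isOpen_ball.mem_nhds (mem_ball_zero_iff.2 hxρ))
  obtain ⟨t, ⟨ht, hlt⟩, y, hy, hyt⟩ :=
    ((hγ.and (hγ1.eventually (lt_mem_nhds hρ))).and (hb.eventually hnhds)).exists
  rw [hi (ball_subset_ball hρ.le hy) ht hyt] at hy
  exact hlt.not_gt (mem_ball_zero_iff.1 hy)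

theorem IsMaMindaConvex.koebeRadius_le_boundaryDist (hψ : IsMaMinda ψ)
    (h : IsConvexExtremal ψ f₀) (hf : IsMaMindaConvex ψ f) :
    koebeRadius f₀ ≤ boundaryDist f := by
  refine csSup_le ((nonempty_Ioo.2 zero_lt_one).image _) (forall_mem_image.2 fun r hr => ?_)
  refine le_boundaryDist_of_forall_le_dist hf.normalized.holo (hf.injOn hψ) hr.2
    fun z hz hrz => ?_
  rw [hf.normalized.zero, dist_zero_left]
  exact ((h.strictMonoOn_negAxis hψ).monotoneOn (Ioo_subset_Ico_self hr) (norm_mem_Ico hz)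
    hrz.le).trans (hf.le_norm hψ h hz)

theorem IsConvexExtremal.boundaryDist_eq (hψ : IsMaMinda ψ) (h : IsConvexExtremal ψ f₀) :
    boundaryDist f₀ = koebeRadius f₀ := by
  have hf := h.isMaMindaConvex
  refine le_antisymm ?_ (hf.koebeRadius_le_boundaryDist hψ h)
  have hnorm : Tendsto (fun t : ℝ => ‖-(t : ℂ)‖) (𝓝[<] 1) (𝓝 1) := by
    have hc : Continuous fun t : ℝ => ‖-(t : ℂ)‖ := by fun_prop
    simpa using (hc.tendsto 1).mono_left nhdsWithin_le_nhds
  have hmem : -(koebeRadius f₀ : ℂ) ∈ frontier (f₀ '' unitDisk) :=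
    mem_frontier_image_of_tendsto h.normalized.holo (hf.injOn hψ) (by
      filter_upwards [Ioo_mem_nhdsLT (zero_lt_one' ℝ)] with t ht
      rw [mem_unitDisk, norm_neg, ← mem_unitDisk]
      exact ofReal_mem_unitDisk ht.1.le ht.2) hnorm (h.tendsto_apply_neg hψ)
  refine (infDist_le_dist_of_mem hmem).trans_eq ?_
  rw [h.normalized.zero, dist_zero_left, norm_neg, Complex.norm_real,
    Real.norm_of_nonneg (h.koebeRadius_pos hψ).le]

end BoundaryDist

/-! ### Bohr sums of harmonic functions -/

section BohrSum

variable {f g f₁ g₁ : ℂ → ℂ} {k r : ℝ}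

theorem eqOn_of_eqOn_harmonicMap (hf : DifferentiableOn ℂ f unitDisk)
    (hg : DifferentiableOn ℂ g unitDisk) (hf₁ : DifferentiableOn ℂ f₁ unitDisk)
    (hg₁ : DifferentiableOn ℂ g₁ unitDisk) (hzero : f₁ 0 = f 0)
    (h : EqOn (harmonicMap f₁ g₁) (harmonicMap f g) unitDisk) :
    EqOn f₁ f unitDisk ∧ EqOn g₁ g unitDisk := by
  have hconn : IsConnected unitDisk := ⟨⟨0, zero_mem_unitDisk⟩, isPreconnected_unitDisk⟩
  have hconj : ∀ z ∈ unitDisk, f₁ z - f z = (starRingEnd ℂ) (g z - g₁ z) := fun z hz => by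
    have hz' : f₁ z + (starRingEnd ℂ) (g₁ z) = f z + (starRingEnd ℂ) (g z) := h hz
    rw [map_sub]
    linear_combination hz'
  obtain ⟨a, ha⟩ := (((hf₁.fun_sub hf).fun_add (hg.fun_sub hg₁)).analyticOnNhd
    isOpen_unitDisk).eq_const_of_im_eq_const (c₀ := 0)
    (fun z hz => by rw [hconj z hz, Complex.add_im, Complex.conj_im, neg_add_cancel])
    isOpen_unitDisk hconn
  obtain ⟨b, hb⟩ := (((hf₁.fun_sub hf).fun_sub (hg.fun_sub hg₁)).analyticOnNhd
    isOpen_unitDisk).eq_const_of_re_eq_const (c₀ := 0)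
    (fun z hz => by rw [hconj z hz, Complex.sub_re, Complex.conj_re, sub_self])
    isOpen_unitDisk hconn
  have hg0 : g 0 - g₁ 0 = 0 := by
    rw [← map_eq_zero (starRingEnd ℂ), ← hconj 0 zero_mem_unitDisk, hzero, sub_self]
  have ha0 : a = 0 := by rw [← ha 0 zero_mem_unitDisk, hzero, hg0, sub_self, add_zero]
  have hb0 : b = 0 := by rw [← hb 0 zero_mem_unitDisk, hzero, hg0, sub_self, sub_zero]
  exact ⟨fun z hz => by linear_combination (ha z hz + hb z hz + ha0 + hb0) / 2,
    fun z hz => by linear_combination (hb z hz - ha z hz + hb0 - ha0) / 2⟩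

theorem hasSum_bohrTerm (hf : DifferentiableOn ℂ f unitDisk) (hg : DifferentiableOn ℂ g unitDisk)
    (hf0 : f 0 = 0) (hg0 : g 0 = 0) (h0 : 0 ≤ r) (h1 : r < 1) :
    HasSum (fun m : ℕ => bohrTerm f g r (m + 1)) (majorant f r + majorant g r) := by
  have htail : ∀ {u : ℂ → ℂ}, DifferentiableOn ℂ u unitDisk → u 0 = 0 →
      HasSum (fun m : ℕ => ‖taylorCoeff u (m + 1)‖ * r ^ (m + 1)) (majorant u r) :=
    fun {u} hu hu0 => by
      rw [hasSum_nat_add_iff (f := fun n => ‖taylorCoeff u n‖ * r ^ n), Finset.sum_range_one,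
        taylorCoeff_zero, hu0, norm_zero, zero_mul, add_zero]
      exact (summable_norm_taylorCoeff_mul_pow hu h0 h1).hasSum
  simpa only [bohrTerm, add_mul] using (htail hf hf0).add (htail hg hg0)

theorem bohrSum_eq_majorant_add_majorant (hf : DifferentiableOn ℂ f unitDisk)
    (hg : DifferentiableOn ℂ g unitDisk) (hf0 : f 0 = 0) (hg0 : g 0 = 0) (h0 : 0 ≤ r)
    (h1 : r < 1) : bohrSum f g r = majorant f r + majorant g r :=
  (hasSum_bohrTerm hf hg hf0 hg0 h0 h1).tsum_eq

theorem bohrSum_const_mul (hf : DifferentiableOn ℂ f unitDisk) (hf0 : f 0 = 0) (c : ℂ)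
    (h0 : 0 ≤ r) (h1 : r < 1) : bohrSum f (fun z => c * f z) r = (1 + ‖c‖) * majorant f r := by
  rw [bohrSum_eq_majorant_add_majorant hf (hf.const_mul c) hf0 (by rw [hf0, mul_zero]) h0 h1,
    majorant_const_mul c hf, add_mul, one_mul]

theorem bohrSum_le_of_subordinate (hf : DifferentiableOn ℂ f unitDisk)
    (hg : DifferentiableOn ℂ g unitDisk) (hf0 : f 0 = 0) (hg0 : g 0 = 0)
    (hf₁ : DifferentiableOn ℂ f₁ unitDisk) (hg₁ : DifferentiableOn ℂ g₁ unitDisk)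
    (hf₁0 : f₁ 0 = 0) (hg₁0 : g₁ 0 = 0)
    (hsub : Subordinate (harmonicMap f₁ g₁) (harmonicMap f g)) (h0 : 0 ≤ r) (h1 : r ≤ 1 / 3) :
    bohrSum f₁ g₁ r ≤ bohrSum f g r := by
  obtain ⟨w, hw, hwe⟩ := hsub
  have hr1 : r < 1 := by linarith
  obtain ⟨hfw, hgw⟩ := eqOn_of_eqOn_harmonicMap (hw.differentiableOn_comp hf)
    (hw.differentiableOn_comp hg) hf₁ hg₁ (by rw [hf₁0, hw.zero, hf0]) hwe
  rw [bohrSum_eq_majorant_add_majorant hf₁ hg₁ hf₁0 hg₁0 h0 hr1,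
    bohrSum_eq_majorant_add_majorant hf hg hf0 hg0 h0 hr1, majorant_congr hfw, majorant_congr hgw]
  exact add_le_add (hw.majorant_comp_le hf h0 h1) (hw.majorant_comp_le hg h0 h1)

theorem majorant_le_of_norm_deriv_div_le (hf : DifferentiableOn ℂ f unitDisk)
    (hg : DifferentiableOn ℂ g unitDisk) (hg0 : g 0 = 0) (hne : ∀ z ∈ unitDisk, deriv f z ≠ 0)
    (hk : ∀ z ∈ unitDisk, ‖deriv g z / deriv f z‖ ≤ k) (h0 : 0 ≤ r) (h1 : r ≤ 1 / 3) :
    majorant g r ≤ k * majorant f r := by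
  have hr1 : r < 1 := by linarith
  have hf' := hf.deriv isOpen_unitDisk
  have hg' := hg.deriv isOpen_unitDisk
  have hμ : DifferentiableOn ℂ (fun z => deriv g z / deriv f z) unitDisk := hg'.fun_div hf' hne
  have hk0 : 0 ≤ k := (norm_nonneg _).trans (hk 0 zero_mem_unitDisk)
  have hderiv : ∀ u ∈ Icc 0 r, majorant (deriv g) u ≤ k * majorant (deriv f) u := fun u hu => by
    rw [majorant_congr (g := fun z => deriv g z / deriv f z * deriv f z)
      fun z hz => (div_mul_cancel₀ _ (hne z hz)).symm]
    exact (majorant_mul_le hμ hf' hu.1 (hu.2.trans_lt hr1)).trans (mul_le_mul_of_nonneg_right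
      (majorant_le_of_bounded hμ hk hu.1 (hu.2.trans h1)) (majorant_nonneg hu.1))
  rw [majorant_eq_integral hf h0 hr1, majorant_eq_integral hg h0 hr1, hg0, norm_zero, zero_add,
    mul_add, ← intervalIntegral.integral_const_mul]
  exact le_add_of_nonneg_of_le (mul_nonneg hk0 (norm_nonneg _))
    (intervalIntegral.integral_mono_on h0 (intervalIntegrable_majorant hg' h0 hr1)
      ((intervalIntegrable_majorant hf' h0 hr1).const_mul k) hderiv)

theorem bohrSum_le_of_norm_deriv_div_le (hf : DifferentiableOn ℂ f unitDisk)
    (hg : DifferentiableOn ℂ g unitDisk) (hf0 : f 0 = 0) (hg0 : g 0 = 0)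
    (hne : ∀ z ∈ unitDisk, deriv f z ≠ 0) (hk : ∀ z ∈ unitDisk, ‖deriv g z / deriv f z‖ ≤ k)
    (h0 : 0 ≤ r) (h1 : r ≤ 1 / 3) : bohrSum f g r ≤ (1 + k) * majorant f r := by
  rw [bohrSum_eq_majorant_add_majorant hf hg hf0 hg0 h0 (by linarith), add_mul, one_mul]
  exact add_le_add_right (majorant_le_of_norm_deriv_div_le hf hg hg0 hne hk h0 h1) _

theorem IsMaMindaConvex.majorant_le {ψ f₀ : ℂ → ℂ} (hψ : IsMaMinda ψ) (h : IsConvexExtremal ψ f₀)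
    (hf : IsMaMindaConvex ψ f) (h0 : 0 ≤ r) (h1 : r ≤ 1 / 3) : majorant f r ≤ majorant f₀ r := by
  obtain ⟨w, hw, hwe⟩ := hf.subord
  have hderiv : deriv (fun z => ψ z - 1) 0 = deriv ψ 0 := deriv_sub_const 1
  exact h.isLogDerivSolution.majorant_le_majorant h.normalized.holo h.deriv_ne hf.normalized.holo
    (hf.normalized.isLogDerivSolution hf.deriv_ne hwe)
    (by rw [hf.normalized.zero, h.normalized.zero]) hw hψ.differentiableOn_sub_one
    (hderiv ▸ hψ.norm_deriv_le_two) (hderiv ▸ hψ.norm_taylorCoeff_sub_one_le) h0 h1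

theorem IsMaMindaConvex.bohrSum_le {ψ f₀ : ℂ → ℂ} (hψ : IsMaMinda ψ) (h : IsConvexExtremal ψ f₀)
    (hf : IsMaMindaConvex ψ f) (hg : DifferentiableOn ℂ g unitDisk) (hg0 : g 0 = 0)
    (hk : ∀ z ∈ unitDisk, ‖deriv g z / deriv f z‖ ≤ k) (hf₁ : DifferentiableOn ℂ f₁ unitDisk)
    (hg₁ : DifferentiableOn ℂ g₁ unitDisk) (hf₁0 : f₁ 0 = 0) (hg₁0 : g₁ 0 = 0)
    (hsub : Subordinate (harmonicMap f₁ g₁) (harmonicMap f g)) (h0 : 0 ≤ r) (h1 : r ≤ 1 / 3) :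
    bohrSum f₁ g₁ r ≤ (1 + k) * majorant f₀ r := by
  have hn := hf.normalized
  have hk0 : 0 ≤ k := (norm_nonneg _).trans (hk 0 zero_mem_unitDisk)
  calc bohrSum f₁ g₁ r ≤ bohrSum f g r :=
        bohrSum_le_of_subordinate hn.holo hg hn.zero hg0 hf₁ hg₁ hf₁0 hg₁0 hsub h0 h1
    _ ≤ (1 + k) * majorant f r :=
        bohrSum_le_of_norm_deriv_div_le hn.holo hg hn.zero hg0 hf.deriv_ne hk h0 h1
    _ ≤ (1 + k) * majorant f₀ r :=
        mul_le_mul_of_nonneg_left (hf.majorant_le hψ h h0 h1) (by linarith)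

end BohrSum

/-! ### The Bohr radius -/

section BohrRadius

variable {f : ℂ → ℂ} {r : ℝ}

theorem add_norm_deriv_deriv_mul_sq_le_majorant (hf : IsNormalized f) (h0 : 0 ≤ r) (h1 : r < 1) :
    r + ‖deriv (deriv f) 0‖ / 2 * r ^ 2 ≤ majorant f r := by
  have hcoeff := taylorCoeff_deriv (f := f) 1
  rw [taylorCoeff_one, Nat.cast_one, one_add_one_eq_two] at hcoeff
  have hsum := (summable_norm_taylorCoeff_mul_pow hf.holo h0 h1).sum_le_tsum {1, 2}
    fun _ _ => by positivity
  rw [Finset.sum_pair (by norm_num), taylorCoeff_one, hf.deriv_zero, norm_one, one_mul,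
    pow_one] at hsum
  rwa [hcoeff, norm_mul, Complex.norm_ofNat, mul_div_cancel_left₀ _ two_ne_zero]

theorem exists_one_lt_majorant (hf : IsNormalized f) (hne : deriv (deriv f) 0 ≠ 0) :
    ∃ r ∈ Ioo (0 : ℝ) 1, 1 < majorant f r := by
  have hlim : Tendsto (fun r : ℝ => r + ‖deriv (deriv f) 0‖ / 2 * r ^ 2) (𝓝[<] 1)
      (𝓝 (1 + ‖deriv (deriv f) 0‖ / 2 * 1 ^ 2)) :=
    (Continuous.tendsto (by fun_prop) 1).mono_left nhdsWithin_le_nhds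
  have hlt : 1 < 1 + ‖deriv (deriv f) 0‖ / 2 * 1 ^ 2 := by
    have hpos := norm_pos_iff.2 hne
    linarith
  obtain ⟨r, hr, hrI⟩ :=
    ((hlim.eventually (lt_mem_nhds hlt)).and (Ioo_mem_nhdsLT (zero_lt_one' ℝ))).exists
  exact ⟨r, hrI, hr.trans_le (add_norm_deriv_deriv_mul_sq_le_majorant hf hrI.1.le hrI.2)⟩

theorem existsUnique_mul_majorant_eq (hf : IsNormalized f) (hne : deriv (deriv f) 0 ≠ 0) {c L : ℝ}
    (hc : 1 ≤ c) (hL0 : 0 < L) (hL1 : L ≤ 1) :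
    ∃! r, r ∈ Ioo (0 : ℝ) 1 ∧ c * majorant f r = L := by
  obtain ⟨t, ht, ht1⟩ := exists_one_lt_majorant hf hne
  have hcont : ContinuousOn (fun r => c * majorant f r) (Icc 0 t) :=
    continuousOn_const.mul ((continuousOn_majorant hf.holo).mono (Icc_subset_Ico_right ht.2))
  have hL : L ∈ Ioo (c * majorant f 0) (c * majorant f t) := by
    rw [majorant_zero, hf.zero, norm_zero, mul_zero]
    exact ⟨hL0, hL1.trans_lt (ht1.trans_le (le_mul_of_one_le_left (by linarith) hc))⟩
  obtain ⟨r, hr, hrL⟩ := intermediate_value_Ioo ht.1.le hcont hL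
  have hr1 : r ∈ Ioo (0 : ℝ) 1 := ⟨hr.1, hr.2.trans ht.2⟩
  refine ⟨r, ⟨hr1, hrL⟩, fun s ⟨hs, hsL⟩ => ?_⟩
  exact (strictMonoOn_majorant hf.holo (by rw [hf.deriv_zero]; exact one_ne_zero)).injOn
    (Ioo_subset_Ico_self hs) (Ioo_subset_Ico_self hr1)
    (mul_left_cancel₀ (by linarith : c ≠ 0) (hsL.trans hrL.symm))

theorem IsConvexExtremal.deriv_deriv_ne_zero {ψ f₀ : ℂ → ℂ} (hψ : IsMaMinda ψ)
    (h : IsConvexExtremal ψ f₀) : deriv (deriv f₀) 0 ≠ 0 := by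
  rw [h.isLogDerivSolution.deriv_eq hψ.differentiableOn_sub_one, deriv_sub_const]
  exact hψ.deriv_ne_zero

end BohrRadius

/-! ### Quasiconformal harmonic mappings -/

section Quasiconformal

variable {f : ℂ → ℂ} {k K : ℝ}

theorem isEmbedding_domRestrict (hf : DifferentiableOn ℂ f unitDisk) (hi : InjOn f unitDisk) :
    IsEmbedding (unitDisk.domRestrict f) := by
  refine (IsOpenEmbedding.of_continuous_injective_isOpenMap
    (continuousOn_iff_continuous_domRestrict.1 hf.continuousOn) hi.injective
    (IsOpenMap.of_nhds_le fun a V hV => ?_)).isEmbedding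
  obtain ⟨u, hu, hsub⟩ := (mem_nhds_subtype _ _ _).1 (mem_map.1 hV)
  have ha := unitDisk_mem_nhds a.2
  refine mem_of_superset (image_mem_nhds_of_injOn (hf.analyticAt ha) hi ha (inter_mem hu ha)) ?_
  rintro _ ⟨x, ⟨hxu, hx⟩, rfl⟩
  exact hsub (show (⟨x, hx⟩ : unitDisk) ∈ Subtype.val ⁻¹' u from hxu)

theorem isEmbedding_add_conj_mul (hk0 : 0 ≤ k) (hk1 : k < 1) :
    IsEmbedding fun ζ : ℂ => ζ + (starRingEnd ℂ) (k * ζ) := by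
  have hk : (1 - (k : ℂ) ^ 2) ≠ 0 := by
    have hk' : 1 - k ^ 2 ≠ 0 := by nlinarith
    exact_mod_cast hk'
  refine Function.LeftInverse.isEmbedding
    (f := fun ζ => (ζ - k * (starRingEnd ℂ) ζ) / (1 - (k : ℂ) ^ 2)) (fun ζ => ?_)
    (by fun_prop) (by fun_prop)
  simp only [map_add, map_mul, Complex.conj_conj, Complex.conj_ofReal]
  field_simp
  ring

theorem sub_one_div_add_one_nonneg (hK : 1 ≤ K) : 0 ≤ (K - 1) / (K + 1) :=
  div_nonneg (by linarith) (by linarith)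

theorem sub_one_div_add_one_lt_one (hK : 1 ≤ K) : (K - 1) / (K + 1) < 1 :=
  (div_lt_one (by linarith)).2 (by linarith)

theorem one_add_sub_one_div_add_one (hK : 1 ≤ K) : 1 + (K - 1) / (K + 1) = 2 * K / (K + 1) := by
  field_simp
  ring

theorem isQuasiconformalHarmonic_const_mul (hK : 1 ≤ K) (hf : DifferentiableOn ℂ f unitDisk)
    (hf0 : f 0 = 0) (hne : ∀ z ∈ unitDisk, deriv f z ≠ 0) (hi : InjOn f unitDisk) :
    IsQuasiconformalHarmonic K f fun z => (((K - 1) / (K + 1) : ℝ) : ℂ) * f z := by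
  have hk0 := sub_one_div_add_one_nonneg hK
  have hk1 := sub_one_div_add_one_lt_one hK
  have hnorm : ‖(((K - 1) / (K + 1) : ℝ) : ℂ)‖ = (K - 1) / (K + 1) := by
    rw [Complex.norm_real, Real.norm_of_nonneg hk0]
  have hderiv : ∀ z ∈ unitDisk, deriv (fun z => (((K - 1) / (K + 1) : ℝ) : ℂ) * f z) z =
      (((K - 1) / (K + 1) : ℝ) : ℂ) * deriv f z := fun z hz =>
    deriv_const_mul _ (hf.differentiableAt (unitDisk_mem_nhds hz))
  refine ⟨hf, hf.const_mul _, by rw [hf0, mul_zero],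
    (isEmbedding_add_conj_mul hk0 hk1).comp (isEmbedding_domRestrict hf hi), fun z hz => ?_,
    fun z hz => ?_⟩
  · have hpos : 0 < ‖deriv f z‖ ^ 2 := pow_pos (norm_pos_iff.2 (hne z hz)) 2
    rw [hderiv z hz, norm_mul, hnorm, mul_pow, sub_pos]
    exact mul_lt_of_lt_one_left hpos (pow_lt_one₀ hk0 hk1 two_ne_zero)
  · rw [hderiv z hz, mul_div_cancel_right₀ _ (hne z hz), hnorm]

end Quasiconformal

/-! ### The Bohr inequality and its sharpness -/

section MaMindaBohr

variable {ψ f f₀ g f₁ g₁ : ℂ → ℂ} {K r r₀ : ℝ}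

theorem IsMaMindaConvex.bohrSum_le_boundaryDist (hψ : IsMaMinda ψ) (h : IsConvexExtremal ψ f₀)
    (hK : 1 ≤ K) (hr₀ : r₀ < 1) (hroot : 2 * K / (K + 1) * majorant f₀ r₀ = koebeRadius f₀)
    (hf : IsMaMindaConvex ψ f) (hg : DifferentiableOn ℂ g unitDisk) (hg0 : g 0 = 0)
    (hdil : ∀ z ∈ unitDisk, ‖deriv g z / deriv f z‖ ≤ (K - 1) / (K + 1))
    (hf₁ : DifferentiableOn ℂ f₁ unitDisk) (hg₁ : DifferentiableOn ℂ g₁ unitDisk)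
    (hf₁0 : f₁ 0 = 0) (hg₁0 : g₁ 0 = 0)
    (hsub : Subordinate (harmonicMap f₁ g₁) (harmonicMap f g)) (h0 : 0 ≤ r)
    (hr : r ≤ min r₀ (1 / 3)) : bohrSum f₁ g₁ r ≤ boundaryDist f := by
  have hc : 0 ≤ 2 * K / (K + 1) := div_nonneg (by linarith) (by linarith)
  calc bohrSum f₁ g₁ r ≤ (1 + (K - 1) / (K + 1)) * majorant f₀ r :=
        hf.bohrSum_le hψ h hg hg0 hdil hf₁ hg₁ hf₁0 hg₁0 hsub h0 (hr.trans (min_le_right _ _))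
    _ = 2 * K / (K + 1) * majorant f₀ r := by rw [one_add_sub_one_div_add_one hK]
    _ ≤ 2 * K / (K + 1) * majorant f₀ r₀ := mul_le_mul_of_nonneg_left
        (majorant_mono h.normalized.holo h0 (hr.trans (min_le_left _ _)) hr₀) hc
    _ = koebeRadius f₀ := hroot
    _ ≤ boundaryDist f := hf.koebeRadius_le_boundaryDist hψ h

theorem IsConvexExtremal.bohrSum_const_mul_eq (h : IsConvexExtremal ψ f₀) (hK : 1 ≤ K)
    (h0 : 0 ≤ r) (h1 : r < 1) :
    bohrSum f₀ (fun z => (((K - 1) / (K + 1) : ℝ) : ℂ) * f₀ z) r =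
      2 * K / (K + 1) * majorant f₀ r := by
  rw [bohrSum_const_mul h.normalized.holo h.normalized.zero _ h0 h1, Complex.norm_real,
    Real.norm_of_nonneg (sub_one_div_add_one_nonneg hK), one_add_sub_one_div_add_one hK]

theorem IsConvexExtremal.boundaryDist_lt_bohrSum_const_mul (hψ : IsMaMinda ψ)
    (h : IsConvexExtremal ψ f₀) (hK : 1 ≤ K) (hr₀ : 0 ≤ r₀)
    (hroot : 2 * K / (K + 1) * majorant f₀ r₀ = koebeRadius f₀) (hr : r₀ < r) (hr1 : r < 1) :
    boundaryDist f₀ < bohrSum f₀ (fun z => (((K - 1) / (K + 1) : ℝ) : ℂ) * f₀ z) r := by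
  have hc : 0 < 2 * K / (K + 1) := div_pos (by linarith) (by linarith)
  have hf1 : deriv f₀ 0 ≠ 0 := h.deriv_ne 0 zero_mem_unitDisk
  rw [h.bohrSum_const_mul_eq hK (hr₀.trans hr.le) hr1, h.boundaryDist_eq hψ, ← hroot]
  exact mul_lt_mul_of_pos_left (strictMonoOn_majorant h.normalized.holo hf1
    ⟨hr₀, hr.trans hr1⟩ ⟨hr₀.trans hr.le, hr1⟩ hr) hc

end MaMindaBohr

theorem mainTheorem3_general (ψ : ℂ → ℂ) (hψ : IsMaMinda ψ) :
    ∃ f₀ : ℂ → ℂ, IsConvexExtremal ψ f₀ ∧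
      (∀ F : ℂ → ℂ, IsConvexExtremal ψ F → EqOn F f₀ unitDisk) ∧
    ∃ L : ℝ, 0 < L ∧
      Tendsto (fun t : ℝ => f₀ (-(t : ℂ))) (𝓝[<] (1 : ℝ)) (𝓝 (-(L : ℂ))) ∧
    ∀ K : ℝ, 1 ≤ K →
    ∃ r₀ : ℝ, (r₀ ∈ Ioo (0 : ℝ) 1 ∧ 2 * K / (K + 1) * majorant f₀ r₀ = L) ∧
      (∀ s ∈ Ioo (0 : ℝ) 1, 2 * K / (K + 1) * majorant f₀ s = L → s = r₀) ∧
      (∀ f g f₁ g₁ : ℂ → ℂ,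
        IsMaMindaConvex ψ f → DifferentiableOn ℂ g unitDisk → g 0 = 0 →
        (∀ z ∈ unitDisk, ‖deriv g z / deriv f z‖ ≤ (K - 1) / (K + 1)) →
        DifferentiableOn ℂ f₁ unitDisk → DifferentiableOn ℂ g₁ unitDisk →
        f₁ 0 = 0 → g₁ 0 = 0 →
        Subordinate (harmonicMap f₁ g₁) (harmonicMap f g) →
        ∀ r : ℝ, 0 ≤ r → r ≤ min r₀ (1 / 3) →
          Summable (fun m : ℕ => bohrTerm f₁ g₁ r (m + 1)) ∧
          bohrSum f₁ g₁ r ≤ boundaryDist f) ∧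
      ∀ g₀ : ℂ → ℂ, g₀ = (fun z => (((K - 1) / (K + 1) : ℝ) : ℂ) * f₀ z) →
        IsMaMindaConvex ψ f₀ ∧ IsQuasiconformalHarmonic K f₀ g₀ ∧
        bohrSum f₀ g₀ r₀ = boundaryDist f₀ ∧
        ∀ r : ℝ, r₀ < r → r < 1 →
          Summable (fun m : ℕ => bohrTerm f₀ g₀ r (m + 1)) ∧
          boundaryDist f₀ < bohrSum f₀ g₀ r := by
  obtain ⟨f₀, h⟩ := hψ.exists_isConvexExtremal
  refine ⟨f₀, h, fun F hF => hF.eqOn h, koebeRadius f₀, h.koebeRadius_pos hψ,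
    h.tendsto_apply_neg hψ, fun K hK => ?_⟩
  have hc : 1 ≤ 2 * K / (K + 1) := (one_le_div (by linarith)).2 (by linarith)
  obtain ⟨r₀, ⟨hr₀, hroot⟩, huniq⟩ := existsUnique_mul_majorant_eq h.normalized
    (h.deriv_deriv_ne_zero hψ) hc (h.koebeRadius_pos hψ) (h.koebeRadius_le_one hψ)
  refine ⟨r₀, ⟨hr₀, hroot⟩, fun s hs hsL => huniq s ⟨hs, hsL⟩, ?_, ?_⟩
  · intro f g f₁ g₁ hf hg hg0 hdil hf₁ hg₁ hf₁0 hg₁0 hsub r h0 hr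
    have hr1 : r < 1 := (hr.trans (min_le_left _ _)).trans_lt hr₀.2
    exact ⟨(hasSum_bohrTerm hf₁ hg₁ hf₁0 hg₁0 h0 hr1).summable,
      hf.bohrSum_le_boundaryDist hψ h hK hr₀.2 hroot hg hg0 hdil hf₁ hg₁ hf₁0 hg₁0 hsub h0 hr⟩
  · rintro g₀ rfl
    have hqc := isQuasiconformalHarmonic_const_mul hK h.normalized.holo h.normalized.zero
      h.deriv_ne (h.isMaMindaConvex.injOn hψ)
    refine ⟨h.isMaMindaConvex, hqc, ?_, fun r hr hr1 => ⟨?_, ?_⟩⟩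
    · rw [h.bohrSum_const_mul_eq hK hr₀.1.le hr₀.2, hroot, h.boundaryDist_eq hψ]
    · exact (hasSum_bohrTerm h.normalized.holo hqc.holo_g h.normalized.zero hqc.g_zero
        (hr₀.1.le.trans hr.le) hr1).summable
    · exact h.boundaryDist_lt_bohrSum_const_mul hψ hK hr₀.1.le hroot hr hr1

theorem mainTheorem3 (ψ : ℂ → ℂ) (hψ : IsMaMinda ψ) :
    -- the solution `f₀`, unique on the disk, and the number `L = -f₀(-1)` (radial limit)
    ∃ f₀ : ℂ → ℂ, IsConvexExtremal ψ f₀ ∧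
      (∀ F : ℂ → ℂ, IsConvexExtremal ψ F → EqOn F f₀ unitDisk) ∧
    ∃ L : ℝ, 0 < L ∧
      Tendsto (fun t : ℝ => f₀ (-(t : ℂ))) (𝓝[<] (1 : ℝ)) (𝓝 (-(L : ℂ))) ∧
    ∀ K : ℝ, 1 ≤ K →
    -- the unique root `r₀`
    ∃ r₀ : ℝ, (r₀ ∈ Ioo (0 : ℝ) 1 ∧ 2 * K / (K + 1) * majorant f₀ r₀ = L) ∧
      (∀ s ∈ Ioo (0 : ℝ) 1, 2 * K / (K + 1) * majorant f₀ s = L → s = r₀) ∧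
      -- the Bohr inequality
      (∀ f g f₁ g₁ : ℂ → ℂ,
        IsMaMindaConvex ψ f → IsQuasiconformalHarmonic K f g →
        DifferentiableOn ℂ f₁ unitDisk → DifferentiableOn ℂ g₁ unitDisk →
        f₁ 0 = 0 → g₁ 0 = 0 →
        Subordinate (harmonicMap f₁ g₁) (harmonicMap f g) →
        ∀ r : ℝ, 0 ≤ r → r ≤ min r₀ (1 / 3) →
          Summable (fun m : ℕ => bohrTerm f₁ g₁ r (m + 1)) ∧
          bohrSum f₁ g₁ r ≤ boundaryDist f) ∧
      -- sharpness for `p = f₀ + k conj f₀`, `k = (K-1)/(K+1)`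
      ((∀ n : ℕ, taylorCoeff f₀ n = (‖taylorCoeff f₀ n‖ : ℂ)) → min r₀ (1 / 3) = r₀ →
        ∀ g₀ : ℂ → ℂ, g₀ = (fun z => (((K - 1) / (K + 1) : ℝ) : ℂ) * f₀ z) →
          IsMaMindaConvex ψ f₀ ∧ IsQuasiconformalHarmonic K f₀ g₀ ∧
          bohrSum f₀ g₀ r₀ = boundaryDist f₀ ∧
          ∀ r : ℝ, r₀ < r → r < 1 →
            Summable (fun m : ℕ => bohrTerm f₀ g₀ r (m + 1)) ∧
            boundaryDist f₀ < bohrSum f₀ g₀ r) := by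
  obtain ⟨f₀, h, hF, L, hL, hlim, hK⟩ := mainTheorem3_general ψ hψ
  refine ⟨f₀, h, hF, L, hL, hlim, fun K hK1 => ?_⟩
  obtain ⟨r₀, hr₀, huniq, hbohr, hsharp⟩ := hK K hK1
  exact ⟨r₀, hr₀, huniq, fun f g f₁ g₁ hf hfg =>
    hbohr f g f₁ g₁ hf hfg.holo_g hfg.g_zero hfg.dilatation_le, fun _ _ => hsharp⟩
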